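/- A 4-QBF is a closed formula $\phi=(Q_1x_1)\cdots(Q_nx_n)\,\psi$ with $Q_i\in\{\exists,\forall\}$, where $\psi$ is a 4-CNF on $x_1,\dots,x_n$, that is, a conjunction of clauses with at most $4$ literals each. Write $k$ for the number of existentially quantified variables and $|\phi|$ for the length of a standard encoding of $\phi$ as a string (variable indices in unary, so $n\le|\phi|$). **Theorem.** Assume the Exponential Time Hypothesis (ETH), in the form that no (deterministic, multi-stack Turing machine) algorithm decides satisfiability of 3-CNF formulas $\varphi$ with $n$ variables in time $2^{o(n)}\cdot|\varphi|^{O(1)}$. Then no such algorithm decides, given a 4-QBF $\phi$ with $k$ existential variables, whether $\phi$ is true in time $2^{2^{o(k)}}\cdot|\phi|^{O(1)}$. In particular, there is none with running time $2^{2^{o(k)}}\cdot n^{O(1)}$, where $n$ is the number of variables of $\phi$. In detail: there are no function $f:\mathbb N\to\mathbb R$ with $f(k)=o(k)$, polynomial $p$, and algorithm that decides every 4-QBF $\phi$ within $2^{2^{f(k)}}\cdot p(|\phi|)$ steps. -/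

import Mathlib

open scoped Asymptotics

/-! ### Propositional formulas in conjunctive normal form -/

/-- A literal: the variable with index `var`, negated when `positive = false`. -/
structure Literal where
  var : ℕ
  positive : Bool
deriving DecidableEq

/-- A clause, read as the disjunction of its literals. -/
abbrev Clause := List Literal

/-- A formula in conjunctive normal form, read as the conjunction of its clauses. -/
abbrev CNF := List Clause

/-- The truth value of a literal under an assignment. -/
def Literal.Holds (σ : ℕ → Bool) (l : Literal) : Prop := σ l.var = l.positive

/-- A CNF is true when each of its clauses contains a true literal. -/
def CNF.Holds (σ : ℕ → Bool) (ψ : CNF) : Prop := ∀ C ∈ ψ, ∃ l ∈ C, l.Holds σ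

/-- Every clause has at most `d` literals. -/
def CNF.ArityLE (d : ℕ) (ψ : CNF) : Prop := ∀ C ∈ ψ, C.length ≤ d

/-- All variables of the formula are among the variables `0, …, n - 1`. -/
def CNF.VarsLT (n : ℕ) (ψ : CNF) : Prop := ∀ C ∈ ψ, ∀ l ∈ C, l.var < n

/-- An instance of `d`-SAT: a `d`-CNF on the variables `0, …, numVars - 1`. -/
structure SATInstance (d : ℕ) where
  numVars : ℕ
  formula : CNF
  arity : formula.ArityLE d
  vars : formula.VarsLT numVars

/-- The formula has a satisfying assignment. -/
def SATInstance.Satisfiable {d : ℕ} (φ : SATInstance d) : Prop :=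
  ∃ σ : ℕ → Bool, φ.formula.Holds σ

/-! ### Quantified Boolean formulas -/

/-- The two quantifiers. -/
inductive Quantifier
  | ex
  | all
deriving DecidableEq

/-- A `d`-QBF `(Q₀ x₀) … (Qₙ₋₁ xₙ₋₁) ψ`: `quants` is the list `Q₀, …, Qₙ₋₁`, and the matrix `ψ`
is a `d`-CNF all of whose variables are quantified. -/
structure QBF (d : ℕ) where
  quants : List Quantifier
  formula : CNF
  arity : formula.ArityLE d
  vars : formula.VarsLT quants.length

/-- Truth of `(Q₀ xᵢ) (Q₁ xᵢ₊₁) … ψ`, where the variables before `xᵢ` have the values given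
by `σ`. -/
def QuantifiedTrue (ψ : CNF) : List Quantifier → ℕ → (ℕ → Bool) → Prop
  | [], _, σ => ψ.Holds σ
  | Quantifier.ex :: qs, i, σ => ∃ b : Bool, QuantifiedTrue ψ qs (i + 1) (Function.update σ i b)
  | Quantifier.all :: qs, i, σ => ∀ b : Bool, QuantifiedTrue ψ qs (i + 1) (Function.update σ i b)

/-- The (closed) quantified formula is true. The initial assignment is irrelevant, since every
variable of the matrix is quantified. -/
def QBF.IsTrue {d : ℕ} (φ : QBF d) : Prop :=
  QuantifiedTrue φ.formula φ.quants 0 (fun _ => false)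

/-- The number of existentially quantified variables. -/
def QBF.numExistential {d : ℕ} (φ : QBF d) : ℕ := φ.quants.count Quantifier.ex

/-! ### Encoding of instances as strings -/

/-- The input alphabet. -/
inductive InputSymbol
  | ex
  | all
  | pos
  | neg
  | tick
  | sep
deriving DecidableEq

/-- A literal: its sign, followed by the index of its variable in unary. -/
def Literal.encode (l : Literal) : List InputSymbol :=
  (if l.positive then InputSymbol.pos else InputSymbol.neg) :: List.replicate l.var InputSymbol.tick

/-- A clause: its literals one after the other, followed by a separator. -/
def Clause.encode (C : Clause) : List InputSymbol := C.flatMap Literal.encode ++ [InputSymbol.sep]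

/-- A CNF: its clauses one after the other. -/
def CNF.encode (ψ : CNF) : List InputSymbol := ψ.flatMap Clause.encode

/-- A SAT instance: its number of variables in unary, followed by the formula. -/
def SATInstance.encode {d : ℕ} (φ : SATInstance d) : List InputSymbol :=
  List.replicate φ.numVars InputSymbol.tick ++ φ.formula.encode

/-- The symbol for a quantifier. -/
def Quantifier.encode : Quantifier → InputSymbol
  | Quantifier.ex => InputSymbol.ex
  | Quantifier.all => InputSymbol.all

/-- A QBF: its quantifiers, followed by the matrix. -/
def QBF.encode {d : ℕ} (φ : QBF d) : List InputSymbol :=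
  φ.quants.map Quantifier.encode ++ φ.formula.encode

/-! ### Running times and the Exponential Time Hypothesis -/

/-- Some deterministic Turing machine with finitely many stacks decides the property `P` of the
instances in `α`: started on the encoding of `a`, it halts after at most `T a` steps with the answer
(the truth value of `P a`) as its output. -/
def DecidableInTime {α Γ : Type} (enc : α → List Γ) (P : α → Prop) (T : α → ℝ) : Prop :=
  ∃ M : Turing.TM2ComputableAux Γ Bool, ∀ a : α, ∃ answer : Bool, (answer = true ↔ P a) ∧
    ∃ t : ℕ, (t : ℝ) ≤ T a ∧
      Nonempty (Turing.TM2OutputsInTime M.tm ((enc a).map M.inputAlphabet.symm)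
        (some [M.outputAlphabet.symm answer]) t)

/-- The Exponential Time Hypothesis: 3-SAT on `n` variables cannot be decided in time
`2 ^ o(n) * |φ| ^ O(1)`, where `|φ|` is the length of the input. -/
def ETH : Prop :=
  ¬ ∃ (f : ℕ → ℝ) (p : Polynomial ℕ), f =o[Filter.atTop] (fun n : ℕ => (n : ℝ)) ∧
    DecidableInTime (SATInstance.encode (d := 3)) SATInstance.Satisfiable
      (fun φ => (2 : ℝ) ^ f φ.numVars * (p.eval φ.encode.length : ℕ))

/-! ### A small programming language over stacks -/

/-! Unsatisfiability of a 3-CNF in n variables reduces in polynomial time to truth of a 4-QBF with k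
= O(log n) existential variables. If f(k) = o(k), then 2^f(k) is at most √(2n+2) for large n, hence
o(n). A decision procedure for 4-QBFs with the forbidden running time, its answer negated, would
thus decide 3-SAT in time 2^o(n) times a polynomial, against ETH.

The formula is a game. The universal player fixes an assignment; the existential player wants to
exhibit a falsified clause and writes the codes of its literals, which takes O(log n) bits. A 4-CNF
cannot directly compare such strings with numbers. So the universal player, whose variables are free
of charge, translates: for each string and each possible value c, one variable claims that the
string is the binary expansion of c. Given the claims, "the named literals are false and cover a
clause" becomes a family of clauses with at most three claims and one guard.

Claims may be lies, so lies have to be exposed. To refute the claim that a string is c, the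
existential player writes c itself, cut into halves, in the next block, and points to a bit where c
and the string differ. If the claims a, b about the halves are true, clauses with four literals
check that the composed value was indeed claimed. Otherwise there is a lie about strings half as
long. After `H` halvings the strings are single bits, and clauses see the lie directly. Claiming
nothing does not help, since requirements are triggered by claims made and never by claims withheld.
In the end the existential player opens a gate, that is, selects one accusation; a chain of
variables forces some gate open while keeping clauses short. The string lengths form a geometric
series with sum O(2 ^ H) = O(log n), and each string has at most (2n+2)^2 possible values.

The two directions of correctness are `Refutation.not_quantifiedTrue_of_honest` and
`Refutation.quantifiedTrue_of_lie`, both resting on `Refutation.quantifiedTrue_gates`; they are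
joined in `Refutation.quantifiedTrue_iff`. The count is in `Refutation.existentials_le` and
`Refutation.isLittleO_two_rpow`.

Polynomial time on an actual machine is obtained in three layers: stack programs, compiled in
`StackProgram.Runs.stepsTo`; `Emitter` expressions, which loop only over lists already at hand and
so are polynomial by structural induction (`Emitter.exists_boundedBy`); and the predicate
`Computes`, whose closure properties reduce the claim to the shape of the construction.
`DecidableInTime.of_program` puts a program in front of a decision machine. -/

instance : Fintype InputSymbol :=
  ⟨{.ex, .all, .pos, .neg, .tick, .sep}, fun x => by cases x <;> decide⟩

/-- Programs acting on stacks indexed by the natural numbers. -/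
inductive StackProgram (A : Type) : Type
  | skip : StackProgram A
  | push (r : ℕ) (a : A) : StackProgram A
  | pop (r : ℕ) : StackProgram A
  | seq (c d : StackProgram A) : StackProgram A
  | whilePop (r : ℕ) (b : A → StackProgram A) : StackProgram A
  | ifEmpty (r : ℕ) (c d : StackProgram A) : StackProgram A

namespace StackProgram

open Function Turing

variable {A : Type}

/-- `Runs c S S' t`: started on the stacks `S`, the program `c` ends with the stacks `S'` after `t`
machine steps. -/
inductive Runs : StackProgram A → (ℕ → List A) → (ℕ → List A) → ℕ → Prop
  | skip (S) : Runs skip S S 1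
  | push (r a S) : Runs (push r a) S (update S r (a :: S r)) 1
  | pop (r S) : Runs (pop r) S (update S r (S r).tail) 1
  | seq {c d S S₁ S₂ t₁ t₂} : Runs c S S₁ t₁ → Runs d S₁ S₂ t₂ → Runs (seq c d) S S₂ (t₁ + t₂)
  | while_nil {r b S} : S r = [] → Runs (whilePop r b) S S 1
  | while_cons {r b S a L S₁ S₂ t₁ t₂} : S r = a :: L → Runs (b a) (update S r L) S₁ t₁ →
      Runs (whilePop r b) S₁ S₂ t₂ → Runs (whilePop r b) S S₂ (1 + t₁ + t₂)
  | if_nil {r c d S S₁ t} : S r = [] → Runs c S S₁ t → Runs (ifEmpty r c d) S S₁ (1 + t)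
  | if_cons {r c d S S₁ t} : S r ≠ [] → Runs d S S₁ t → Runs (ifEmpty r c d) S S₁ (1 + t)

/-- All stacks that the program uses have an index below `B`. -/
def Below (B : ℕ) : StackProgram A → Prop
  | skip => True
  | push r _ => r < B
  | pop r => r < B
  | seq c d => c.Below B ∧ d.Below B
  | whilePop r b => r < B ∧ ∀ a, (b a).Below B
  | ifEmpty r c d => r < B ∧ c.Below B ∧ d.Below B

theorem Below.mono {B B' : ℕ} (h : B ≤ B') : ∀ {c : StackProgram A}, c.Below B → c.Below B'
  | skip, _ => trivial
  | push _ _, hc => lt_of_lt_of_le hc h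
  | pop _, hc => lt_of_lt_of_le hc h
  | seq _ _, hc => ⟨hc.1.mono h, hc.2.mono h⟩
  | whilePop _ _, hc => ⟨lt_of_lt_of_le hc.1 h, fun a => (hc.2 a).mono h⟩
  | ifEmpty _ _ _, hc => ⟨lt_of_lt_of_le hc.1 h, hc.2.1.mono h, hc.2.2.mono h⟩

/-- A machine has only finitely many stacks. A loop has one body per symbol, so finiteness of the
alphabet gives a common bound. -/
theorem exists_below [Fintype A] (c : StackProgram A) : ∃ B, c.Below B := by
  induction c with
  | skip => exact ⟨0, trivial⟩
  | push r a => exact ⟨r + 1, Nat.lt_succ_self r⟩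
  | pop r => exact ⟨r + 1, Nat.lt_succ_self r⟩
  | seq c d hc hd =>
    obtain ⟨B, hB⟩ := hc
    obtain ⟨B', hB'⟩ := hd
    exact ⟨max B B', hB.mono (le_max_left _ _), hB'.mono (le_max_right _ _)⟩
  | whilePop r b hb =>
    choose B hB using hb
    exact ⟨max (r + 1) (Finset.univ.sup B), lt_of_lt_of_le (Nat.lt_succ_self r) (le_max_left _ _),
      fun a => (hB a).mono ((Finset.le_sup (Finset.mem_univ a)).trans (le_max_right _ _))⟩
  | ifEmpty r c d hc hd =>
    obtain ⟨B, hB⟩ := hc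
    obtain ⟨B', hB'⟩ := hd
    exact ⟨max (r + 1) (max B B'), lt_of_lt_of_le (Nat.lt_succ_self r) (le_max_left _ _),
      hB.mono ((le_max_left _ _).trans (le_max_right _ _)),
      hB'.mono ((le_max_right _ _).trans (le_max_right _ _))⟩

/-! ### Compilation to machines with several stacks -/

/-- The program points of a program. -/
def Label : StackProgram A → Type
  | skip => Unit
  | push _ _ => Unit
  | pop _ => Unit
  | seq c d => c.Label ⊕ d.Label
  | whilePop _ b => Option (Σ a, (b a).Label)
  | ifEmpty _ c d => Option (c.Label ⊕ d.Label)

theorem finite_label [Finite A] : ∀ c : StackProgram A, Finite c.Label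
  | skip => inferInstanceAs (Finite Unit)
  | push _ _ => inferInstanceAs (Finite Unit)
  | pop _ => inferInstanceAs (Finite Unit)
  | seq c d =>
    have := finite_label c
    have := finite_label d
    inferInstanceAs (Finite (c.Label ⊕ d.Label))
  | whilePop _ b =>
    have := fun a => finite_label (b a)
    inferInstanceAs (Finite (Option (Σ a, (b a).Label)))
  | ifEmpty _ c d =>
    have := finite_label c
    have := finite_label d
    inferInstanceAs (Finite (Option (c.Label ⊕ d.Label)))

/-- The first program point. -/
def entry : (c : StackProgram A) → c.Label
  | skip => ()
  | push _ _ => ()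
  | pop _ => ()
  | seq c _ => Sum.inl c.entry
  | whilePop _ _ => none
  | ifEmpty _ _ _ => none

section Compile

variable {K : Type} (Γ : K → Type) {L σ : Type} (B : ℕ) [NeZero B]

/-- The stack alphabets of a machine that has `B` stacks over `A` besides given ones. -/
@[reducible]
def ExtendedAlphabet (A : Type) : K ⊕ Fin B → Type
  | Sum.inl k => Γ k
  | Sum.inr _ => A

variable {Γ} {B} in
/-- The stacks of a machine that has `B` stacks over `A` besides given ones. -/
def joinStacks (S₀ : ∀ k, List (Γ k)) (S : ℕ → List A) :
    ∀ k, List (ExtendedAlphabet Γ B A k)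
  | Sum.inl k => S₀ k
  | Sum.inr i => S i

variable {Γ} {B} in
theorem update_joinStacks_inr [DecidableEq K] (S₀ : ∀ k, List (Γ k)) (S : ℕ → List A) {r : ℕ}
    (hr : r < B) (x : List A) :
    update (joinStacks (B := B) S₀ S) (Sum.inr (Fin.ofNat B r)) x =
      joinStacks S₀ (update S r x) := by
  funext k
  rcases k with k | i
  · rw [update_of_ne (by simp)]; rfl
  · by_cases h : i = Fin.ofNat B r
    · subst h
      rw [update_self]
      simp [joinStacks, Nat.mod_eq_of_lt hr]
    · rw [update_of_ne (by simpa using h)]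
      have : (i : ℕ) ≠ r := fun e => h (by ext; simp [← e])
      simp [joinStacks, update_of_ne this]

variable {Γ} {B} in
omit [NeZero B] in
theorem update_joinStacks_inl [DecidableEq K] (S₀ : ∀ k, List (Γ k)) (S : ℕ → List A) (k : K)
    (x : List (Γ k)) :
    update (joinStacks (B := B) S₀ S) (Sum.inl k) x = joinStacks (update S₀ k x) S := by
  funext k'
  rcases k' with k' | i
  · by_cases h : k' = k
    · subst h
      rw [update_self]
      simp [joinStacks]
    · rw [update_of_ne (by simpa using h)]
      simp [joinStacks, update_of_ne h]
  · rw [update_of_ne (by simp)]; rfl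

variable {Γ} {B} in
theorem joinStacks_inr (S₀ : ∀ k, List (Γ k)) (S : ℕ → List A) {r : ℕ} (hr : r < B) :
    joinStacks (B := B) S₀ S (Sum.inr (Fin.ofNat B r)) = S r := by
  simp [joinStacks, Nat.mod_eq_of_lt hr]

/-- The machine statements of a program, for given names of its program points and of the point to
go to at its end. -/
def code : (c : StackProgram A) → (c.Label → L) → L → c.Label →
    TM2.Stmt (ExtendedAlphabet Γ B A) L (σ × Option A)
  | skip, _, exit, _ => .goto fun _ => exit
  | push r a, _, exit, _ => .push (Sum.inr (Fin.ofNat B r)) (fun _ => a) (.goto fun _ => exit)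
  | pop r, _, exit, _ => .pop (Sum.inr (Fin.ofNat B r)) (fun v _ => v) (.goto fun _ => exit)
  | seq c d, emb, _, Sum.inl l => c.code (fun l => emb (Sum.inl l)) (emb (Sum.inr d.entry)) l
  | seq _ d, emb, exit, Sum.inr l => d.code (fun l => emb (Sum.inr l)) exit l
  | whilePop r b, emb, exit, none =>
    .pop (Sum.inr (Fin.ofNat B r)) (fun v o => (v.1, o)) (.goto fun v =>
      match v.2 with
      | none => exit
      | some a => emb (some ⟨a, (b a).entry⟩))
  | whilePop _ b, emb, _, some ⟨a, l⟩ =>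
    (b a).code (fun l => emb (some ⟨a, l⟩)) (emb none) l
  | ifEmpty r c d, emb, _, none =>
    .peek (Sum.inr (Fin.ofNat B r)) (fun v o => (v.1, o)) (.goto fun v =>
      match v.2 with
      | none => emb (some (Sum.inl c.entry))
      | some _ => emb (some (Sum.inr d.entry)))
  | ifEmpty _ c _, emb, exit, some (Sum.inl l) =>
    c.code (fun l => emb (some (Sum.inl l))) exit l
  | ifEmpty _ _ d, emb, exit, some (Sum.inr l) =>
    d.code (fun l => emb (some (Sum.inr l))) exit l

end Compile

end StackProgram

/-- `f` leads from `a` to `b` in exactly `t` steps. -/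
def StepsTo {α : Type} (f : α → Option α) (t : ℕ) (a b : α) : Prop :=
  (flip bind f)^[t] (some a) = some b

theorem StepsTo.trans {α : Type} {f : α → Option α} {t t' : ℕ} {a b c : α} (h : StepsTo f t a b)
    (h' : StepsTo f t' b c) : StepsTo f (t + t') a c := by
  unfold StepsTo at *
  rw [add_comm, Function.iterate_add_apply, h, h']

theorem StepsTo.single {α : Type} {f : α → Option α} {a b : α} (h : f a = some b) :
    StepsTo f 1 a b := h

/-! ### Correctness of the compilation -/

namespace StackProgram

open Function Turing

variable {A : Type} {K : Type} [DecidableEq K] {Γ : K → Type} {L σ : Type} {B : ℕ} [NeZero B]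

/-- Induction on the run, for all exits: a subprogram leaves directly to the entry of what follows,
so sequencing costs no step. The symbol last read is unspecified at the end because no program
consults it before overwriting it. -/
theorem Runs.stepsTo {c : StackProgram A} {S S' : ℕ → List A} {t : ℕ} (h : Runs c S S' t)
    (hB : c.Below B) (m : L → TM2.Stmt (ExtendedAlphabet Γ B A) L (σ × Option A))
    (emb : c.Label → L) (exit : L) (hm : ∀ l, m (emb l) = c.code Γ B emb exit l)
    (S₀ : ∀ k, List (Γ k)) (v : σ) (o : Option A) :
    ∃ o', StepsTo (TM2.step m) t ⟨some (emb c.entry), (v, o), joinStacks S₀ S⟩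
      ⟨some exit, (v, o'), joinStacks S₀ S'⟩ := by
  induction h generalizing exit o with
  | skip S =>
    refine ⟨o, .single ?_⟩
    simp [TM2.step, hm, code]
  | push r a S =>
    refine ⟨o, .single ?_⟩
    have hr : r < B := hB
    simp only [TM2.step, hm, code, TM2.stepAux, joinStacks_inr _ _ hr,
      update_joinStacks_inr _ _ hr]
  | pop r S =>
    refine ⟨o, .single ?_⟩
    have hr : r < B := hB
    simp only [TM2.step, hm, code, TM2.stepAux, joinStacks_inr _ _ hr,
      update_joinStacks_inr _ _ hr]
  | @seq c d S S₁ S₂ t₁ t₂ _ _ h₁ h₂ =>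
    obtain ⟨o₁, e₁⟩ := h₁ hB.1 (fun l => emb (Sum.inl l)) (emb (Sum.inr d.entry))
      (fun l => hm (Sum.inl l)) o
    obtain ⟨o₂, e₂⟩ := h₂ hB.2 (fun l => emb (Sum.inr l)) exit (fun l => hm (Sum.inr l)) o₁
    exact ⟨o₂, e₁.trans e₂⟩
  | @while_nil r b S hS =>
    refine ⟨none, .single ?_⟩
    have hr : r < B := hB.1
    have h := update_joinStacks_inr S₀ S hr []
    rw [← hS, update_eq_self] at h
    refine (congrArg (fun q => some (TM2.stepAux q (v, o) (joinStacks S₀ S)))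
      (hm (whilePop r b).entry)).trans ?_
    simp only [entry, code, TM2.stepAux, joinStacks_inr _ _ hr, hS, List.tail_nil,
      List.head?_nil]
    rw [← hS, h]
  | @while_cons r b S a l S₁ S₂ t₁ t₂ hS _ _ h₁ h₂ =>
    have hr : r < B := hB.1
    obtain ⟨o₁, e₁⟩ := h₁ (hB.2 a) (fun l => emb (some ⟨a, l⟩)) (emb none)
      (fun l => hm (some ⟨a, l⟩)) (some a)
    obtain ⟨o₂, e₂⟩ := h₂ hB emb exit hm o₁
    refine ⟨o₂, StepsTo.trans (StepsTo.trans (StepsTo.single ?_) e₁) e₂⟩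
    refine (congrArg (fun q => some (TM2.stepAux q (v, o) (joinStacks S₀ S)))
      (hm (whilePop r b).entry)).trans ?_
    simp only [entry, code, TM2.stepAux, joinStacks_inr _ _ hr, hS, List.tail_cons,
      List.head?_cons, update_joinStacks_inr _ _ hr]
  | @if_nil r c d S S₁ t hS _ h₁ =>
    have hr : r < B := hB.1
    obtain ⟨o₁, e₁⟩ := h₁ hB.2.1 (fun l => emb (some (Sum.inl l))) exit
      (fun l => hm (some (Sum.inl l))) none
    refine ⟨o₁, StepsTo.trans (StepsTo.single ?_) e₁⟩
    refine (congrArg (fun q => some (TM2.stepAux q (v, o) (joinStacks S₀ S)))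
      (hm (ifEmpty r c d).entry)).trans ?_
    simp only [entry, code, TM2.stepAux, joinStacks_inr _ _ hr, hS, List.head?_nil]
  | @if_cons r c d S S₁ t hS _ h₁ =>
    have hr : r < B := hB.1
    obtain ⟨a, l, hl⟩ := List.exists_cons_of_ne_nil hS
    obtain ⟨o₁, e₁⟩ := h₁ hB.2.2 (fun l => emb (some (Sum.inr l))) exit
      (fun l => hm (some (Sum.inr l))) (some a)
    refine ⟨o₁, StepsTo.trans (StepsTo.single ?_) e₁⟩
    refine (congrArg (fun q => some (TM2.stepAux q (v, o) (joinStacks S₀ S)))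
      (hm (ifEmpty r c d).entry)).trans ?_
    simp only [entry, code, TM2.stepAux, joinStacks_inr _ _ hr, hl, List.head?_cons]

/-! ### Running a program before a machine -/

/-- A statement of a machine as a statement of a machine with more stacks and labels. -/
def liftStmt {Λ Λ' : Type} : TM2.Stmt Γ Λ σ →
    TM2.Stmt (ExtendedAlphabet Γ B A) (Λ ⊕ Λ') (σ × Option A)
  | .push k f q => .push (Sum.inl k) (fun v => f v.1) (liftStmt q)
  | .peek k f q => .peek (Sum.inl k) (fun v o => (f v.1 o, v.2)) (liftStmt q)
  | .pop k f q => .pop (Sum.inl k) (fun v o => (f v.1 o, v.2)) (liftStmt q)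
  | .load f q => .load (fun v => (f v.1, v.2)) (liftStmt q)
  | .branch f q q' => .branch (fun v => f v.1) (liftStmt q) (liftStmt q')
  | .goto f => .goto fun v => Sum.inl (f v.1)
  | .halt => .halt

/-- A configuration of a machine as a configuration of a machine with more stacks and labels, all
of whose additional stacks are empty. -/
def liftCfg {Λ Λ' : Type} (c : TM2.Cfg Γ Λ σ) :
    TM2.Cfg (ExtendedAlphabet Γ B A) (Λ ⊕ Λ') (σ × Option A) :=
  ⟨c.l.map Sum.inl, (c.var, none), joinStacks c.stk fun _ => []⟩

omit [NeZero B] in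
-- The original statements touch neither the additional stacks nor the additional component of the
-- state, so both keep their empty values.
theorem stepAux_liftStmt {Λ Λ' : Type} (q : TM2.Stmt Γ Λ σ) (v : σ) (S₀ : ∀ k, List (Γ k)) :
    TM2.stepAux (liftStmt (A := A) (B := B) (Λ' := Λ') q) (v, none) (joinStacks S₀ fun _ => []) =
      liftCfg (TM2.stepAux q v S₀) := by
  induction q generalizing v S₀ with
  | push k f q ih =>
    simp only [liftStmt, TM2.stepAux, update_joinStacks_inl, ← ih]; rfl
  | peek k f q ih => simp only [liftStmt, TM2.stepAux, ← ih]; rfl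
  | pop k f q ih =>
    simp only [liftStmt, TM2.stepAux, update_joinStacks_inl, ← ih]; rfl
  | load f q ih => simp only [liftStmt, TM2.stepAux, ← ih]
  | branch f q q' ih ih' =>
    simp only [liftStmt, TM2.stepAux]
    cases f v <;> simp [ih, ih']
  | goto f => rfl
  | halt => rfl

omit [NeZero B] in
theorem iterate_liftCfg {Λ Λ' : Type} (M : Λ → TM2.Stmt Γ Λ σ)
    (m : Λ ⊕ Λ' → TM2.Stmt (ExtendedAlphabet Γ B A) (Λ ⊕ Λ') (σ × Option A))
    (hm : ∀ l, m (Sum.inl l) = liftStmt (M l)) (t : ℕ) (c : Option (TM2.Cfg Γ Λ σ)) :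
    (flip bind (TM2.step m))^[t] (c.map liftCfg) =
      ((flip bind (TM2.step M))^[t] c).map liftCfg := by
  induction t generalizing c with
  | zero => rfl
  | succ t ih =>
    rw [iterate_succ_apply, iterate_succ_apply, ← ih]
    congr 1
    rcases c with _ | ⟨l, v, S₀⟩
    · rfl
    · rcases l with _ | l
      · rfl
      · change TM2.step m ⟨some (Sum.inl l), (v, none), joinStacks S₀ fun _ => []⟩ = _
        simp only [TM2.step, hm, stepAux_liftStmt]
        rfl

omit [NeZero B] in
theorem StepsTo.liftCfg {Λ Λ' : Type} {M : Λ → TM2.Stmt Γ Λ σ}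
    {m : Λ ⊕ Λ' → TM2.Stmt (ExtendedAlphabet Γ B A) (Λ ⊕ Λ') (σ × Option A)}
    (hm : ∀ l, m (Sum.inl l) = liftStmt (M l)) {t : ℕ} {c d : TM2.Cfg Γ Λ σ}
    (h : StepsTo (TM2.step M) t c d) :
    StepsTo (TM2.step m) t (StackProgram.liftCfg c) (StackProgram.liftCfg d) := by
  have h' := iterate_liftCfg M m hm t (some c)
  rw [show (flip bind (TM2.step M))^[t] (some c) = some d from h] at h'
  exact h'

end StackProgram

/-! ### Composition of a program with a machine -/

namespace StackProgram

open Function Turing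

theorem initList_eq (M : FinTM2) (s : List (M.Γ M.k₀)) :
    initList M s = ⟨some M.main, M.initialState, update (fun _ => []) M.k₀ s⟩ := by
  unfold initList
  congr 1
  funext k
  by_cases h : k = M.k₀
  · subst h
    simp
  · simp [h]

theorem haltList_eq (M : FinTM2) (s : List (M.Γ M.k₁)) :
    haltList M s = ⟨none, M.initialState, update (fun _ => []) M.k₁ s⟩ := by
  unfold haltList
  congr 1
  funext k
  by_cases h : k = M.k₁
  · subst h
    simp
  · simp [h]

variable {A : Type}

/-- The statements of the machine that runs the program `c`, moves the contents of the stack `o`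
to the input stack of `M`, and then runs `M`. -/
def andThenStmt [Inhabited A] (c : StackProgram A) (o B : ℕ) [NeZero B]
    (M : FinTM2) (e : M.Γ M.k₀ ≃ A) : M.Λ ⊕ Option c.Label →
    TM2.Stmt (ExtendedAlphabet M.Γ B A) (M.Λ ⊕ Option c.Label) (M.σ × Option A)
  | Sum.inl l => liftStmt (M.m l)
  | Sum.inr (some l) => c.code M.Γ B (fun l => Sum.inr (some l)) (Sum.inr none) l
  | Sum.inr none =>
    .pop (Sum.inr (Fin.ofNat B o)) (fun v a => (v.1, a)) (.branch (fun v => v.2.isNone)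
      (.goto fun _ => Sum.inl M.main)
      (.push (Sum.inl M.k₀) (fun v => e.symm (v.2.getD default)) (.goto fun _ => Sum.inr none)))

/-- The machine that runs the program `c` with input stack `i`, moves the contents of the
stack `o` to the input stack of `M`, and then runs `M`. -/
noncomputable def andThen [Fintype A] [Inhabited A] (c : StackProgram A) (i o B : ℕ) [NeZero B]
    (M : FinTM2) (e : M.Γ M.k₀ ≃ A) : FinTM2 :=
  letI := M.kFin
  letI := M.ΛFin
  letI := M.σFin
  haveI := c.finite_label
  letI := Fintype.ofFinite c.Label
  { K := M.K ⊕ Fin B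
    k₀ := Sum.inr (Fin.ofNat B i)
    k₁ := Sum.inl M.k₁
    Γ := ExtendedAlphabet M.Γ B A
    Λ := M.Λ ⊕ Option c.Label
    main := Sum.inr (some c.entry)
    σ := M.σ × Option A
    initialState := (M.initialState, none)
    Γk₀Fin := inferInstanceAs (Fintype A)
    m := andThenStmt c o B M e }

theorem joinStacks_nil {K : Type} {Γ : K → Type} {B : ℕ} :
    joinStacks (B := B) (fun k => ([] : List (Γ k))) (fun _ => ([] : List A)) = fun _ => [] := by
  funext k
  rcases k with k | k <;> rfl

/-- Moving symbol by symbol reverses the string, so the program has to leave its result backwards.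
The additional step is the pop of the empty stack, which also resets the stored symbol to `none`, as
`liftCfg` demands. -/
theorem andThen_transfer [Inhabited A] (c : StackProgram A) (o B : ℕ) [NeZero B]
    (ho : o < B) (M : FinTM2) (e : M.Γ M.k₀ ≃ A) (L : List A) (L₀ : List (M.Γ M.k₀))
    (x : Option A) :
    StepsTo (TM2.step (andThenStmt c o B M e)) (L.length + 1)
      ⟨some (Sum.inr none), (M.initialState, x),
        joinStacks (update (fun _ => []) M.k₀ L₀) (update (fun _ => []) o L)⟩
      ⟨some (Sum.inl M.main), (M.initialState, none),
        joinStacks (update (fun _ => []) M.k₀ ((L.map e.symm).reverse ++ L₀)) (fun _ => [])⟩ := by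
  induction L generalizing L₀ x with
  | nil =>
    refine StepsTo.single ?_
    have h := update_joinStacks_inr (update (fun _ => []) M.k₀ L₀)
      (fun _ => ([] : List A)) ho []
    have h' : update (fun _ => ([] : List A)) o [] = fun _ => [] := by
      simp
    simp only [TM2.step, andThenStmt, TM2.stepAux, joinStacks_inr _ _ ho, update_self,
      List.head?_nil, List.tail_nil, Option.isNone_none, cond_true, List.map_nil,
      List.reverse_nil, List.nil_append]
    rw [h'] at h ⊢
    rw [h]
  | cons a L ih =>
    have h₁ := ih (e.symm a :: L₀) (some a)
    rw [List.length_cons]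
    rw [show ((a :: L).map e.symm).reverse ++ L₀ = (L.map e.symm).reverse ++ e.symm a :: L₀ by simp]
    rw [add_comm (L.length + 1)]
    refine StepsTo.trans (StepsTo.single ?_) h₁
    · have h := update_joinStacks_inl (B := B) (update (fun _ => []) M.k₀ L₀)
        (update (fun _ => []) o L) M.k₀ (e.symm a :: L₀)
      rw [update_idem] at h
      simp only [TM2.step, andThenStmt, TM2.stepAux, joinStacks_inr _ _ ho, update_self,
        List.head?_cons, List.tail_cons, Option.isNone_some, cond_false,
        update_joinStacks_inr _ _ ho, update_idem, Option.getD_some]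
      rw [← h]
      simp [joinStacks]

end StackProgram

open StackProgram Function Turing in
/-- A decision procedure for `Q`, applied to the output of a program that computes a reduction from
the complement of `P` to `Q`, is a decision procedure for `P`. -/
theorem DecidableInTime.of_program {α β A : Type} [Fintype A] [Inhabited A] {enc : α → List A}
    {enc' : β → List A} {P : α → Prop} {Q : β → Prop} {f : α → β} {T : β → ℝ}
    (hf : ∀ a, P a ↔ ¬ Q (f a)) (c : StackProgram A) (i o : ℕ) (t : α → ℕ)
    (hc : ∀ a, ∃ t' ≤ t a, Runs c (update (fun _ => []) i (enc a))
      (update (fun _ => []) o (enc' (f a)).reverse) t')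
    (h : DecidableInTime enc' Q T) :
    DecidableInTime enc P (fun a => (t a + ((enc' (f a)).length + 1) : ℕ) + T (f a)) := by
  obtain ⟨M, hM⟩ := h
  obtain ⟨B₀, hB₀⟩ := c.exists_below
  obtain ⟨B, hB, hi, ho, hB0⟩ : ∃ B, c.Below B ∧ i < B ∧ o < B ∧ B ≠ 0 :=
    ⟨B₀ + i + o + 1, hB₀.mono (by omega), by omega, by omega, by omega⟩
  have : NeZero B := ⟨hB0⟩
  -- The answer is negated by renaming the output symbols, which takes no time.
  refine ⟨⟨andThen c i o B M.tm M.inputAlphabet, Equiv.refl A,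
    M.outputAlphabet.trans Equiv.boolNot⟩, fun a => ?_⟩
  obtain ⟨ans, hans, u, hu, ⟨⟨s, hs⟩, hsu⟩⟩ := hM (f a)
  obtain ⟨t', ht', hrun⟩ := hc a
  refine ⟨!ans, ?_, t' + ((enc' (f a)).length + 1) + s, ?_, ⟨⟨⟨_, ?_⟩, le_rfl⟩⟩⟩
  · rw [hf, ← hans]
    cases ans <;> simp
  · have : (s : ℝ) ≤ T (f a) := le_trans (by exact_mod_cast hsu) hu
    have : (t' : ℝ) ≤ t a := by exact_mod_cast ht'
    push_cast
    linarith
  · obtain ⟨x, h₁⟩ := hrun.stepsTo hB (andThenStmt c o B M.tm M.inputAlphabet)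
      (fun l => Sum.inr (some l)) (Sum.inr none) (fun _ => rfl) (fun _ => []) M.tm.initialState none
    have h₂ := andThen_transfer c o B ho M.tm M.inputAlphabet (enc' (f a)).reverse [] x
    rw [show update (fun k => ([] : List (M.tm.Γ k))) M.tm.k₀ [] = fun _ => [] from by simp] at h₂
    have h₃ : StepsTo (TM2.step (andThenStmt c o B M.tm M.inputAlphabet)) s _ _ :=
      StepsTo.liftCfg (B := B) (A := A) (M := M.tm.m)
      (m := andThenStmt c o B M.tm M.inputAlphabet) (fun _ => rfl) (t := s)
      (c := initList M.tm ((enc' (f a)).map M.inputAlphabet.symm))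
      (d := haltList M.tm [M.outputAlphabet.symm ans]) hs
    rw [initList_eq, haltList_eq] at h₃
    rw [List.length_reverse, List.map_reverse, List.reverse_reverse, List.append_nil] at h₂
    have h₄ := (h₁.trans h₂).trans h₃
    have hinit : initList (andThen c i o B M.tm M.inputAlphabet)
        ((enc a).map (Equiv.refl A).symm) = ⟨some (Sum.inr (some c.entry)),
          (M.tm.initialState, none), joinStacks (fun _ => []) (update (fun _ => []) i (enc a))⟩ := by
      rw [initList_eq, ← update_joinStacks_inr _ _ hi, joinStacks_nil]
      refine congrArg (fun S => (⟨_, _, S⟩ : TM2.Cfg _ _ _)) ?_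
      exact congrArg (fun l : List A => update (β := fun k => List (ExtendedAlphabet M.tm.Γ B A k))
        (fun _ => []) (Sum.inr (Fin.ofNat B i)) l) (List.map_id (enc a))
    have hhalt : haltList (andThen c i o B M.tm M.inputAlphabet)
        [(M.outputAlphabet.trans Equiv.boolNot).symm (!ans)] =
        liftCfg ⟨none, M.tm.initialState,
          update (fun _ => []) M.tm.k₁ [M.outputAlphabet.symm ans]⟩ := by
      rw [haltList_eq]
      unfold liftCfg
      simp only
      rw [← update_joinStacks_inl, joinStacks_nil]
      refine congrArg (fun S => (⟨_, _, S⟩ : TM2.Cfg _ _ _)) ?_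
      simp
      rfl
    rw [Option.map_some]
    refine Eq.trans (congrArg _ (congrArg some hinit)) (Eq.trans ?_ (congrArg some hhalt.symm))
    exact h₄

theorem Polynomial.eval_mono_nat (p : Polynomial ℕ) {x y : ℕ} (h : x ≤ y) :
    p.eval x ≤ p.eval y := by
  rw [Polynomial.eval_eq_sum, Polynomial.eval_eq_sum]
  exact Finset.sum_le_sum fun i _ => Nat.mul_le_mul_left _ (Nat.pow_le_pow_left h i)

/-! ### Elementary loops on stacks -/

namespace StackProgram

open Function

variable {A : Type}

theorem Runs.congr {c : StackProgram A} {S S₁ S₂ : ℕ → List A} {t : ℕ} (h : Runs c S S₁ t)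
    (e : S₁ = S₂) : Runs c S S₂ t := e ▸ h

/-- Empty the stack `r`. -/
def clear (r : ℕ) : StackProgram A := whilePop r fun _ => skip

/-- Move the contents of the stack `r` to the stack `s`, which reverses their order. -/
def move (r s : ℕ) : StackProgram A := whilePop r fun a => push s a

/-- Append the contents of the stack `r` to the stack `s`, with the help of the stack `0`. -/
def copy (r s : ℕ) : StackProgram A :=
  seq (move r 0) (whilePop 0 fun a => seq (push r a) (push s a))

theorem runs_clear (r : ℕ) (S : ℕ → List A) :
    Runs (clear r) S (update S r []) (2 * (S r).length + 1) := by
  generalize hL : S r = L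
  induction L generalizing S with
  | nil => exact (Runs.while_nil hL).congr (by rw [← hL, update_eq_self])
  | cons a L ih =>
    have := Runs.while_cons hL (Runs.skip _) (ih (update S r L) (by simp))
    rw [update_idem] at this
    refine Eq.mp ?_ this
    congr 1
    simp only [List.length_cons]; ring

theorem runs_move {r s : ℕ} (hrs : r ≠ s) (S : ℕ → List A) :
    Runs (move r s) S (update (update S r []) s ((S r).reverse ++ S s))
      (2 * (S r).length + 1) := by
  generalize hL : S r = L
  induction L generalizing S with
  | nil =>
    exact (Runs.while_nil hL).congr (by rw [← hL, update_eq_self]; simp [hL])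
  | cons a L ih =>
    have := Runs.while_cons hL (Runs.push s a _)
      (ih (update (update S r L) s (a :: (update S r L) s)) (by simp [hrs]))
    refine Eq.mp ?_ this
    congr 1
    · funext x
      by_cases h₁ : x = s
      · simp [h₁, hrs.symm]
      · by_cases h₂ : x = r <;> simp [h₁, h₂, hrs, hrs.symm]
    · simp only [List.length_cons]; ring

/-- Moving to stack `0` takes two steps per symbol and reverses the order; moving back to both
stacks takes three and restores it. -/
theorem runs_copy {r s : ℕ} (hr : r ≠ 0) (hs : s ≠ 0) (hrs : r ≠ s) (S : ℕ → List A)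
    (h0 : S 0 = []) :
    Runs (copy r s) S (update S s (S r ++ S s)) (5 * (S r).length + 2) := by
  have key : ∀ (L : List A) (S : ℕ → List A), S 0 = L →
      Runs (whilePop 0 fun a => seq (push r a) (push s a)) S
        (update (update (update S 0 []) r (L.reverse ++ S r)) s (L.reverse ++ S s))
        (3 * L.length + 1) := by
    intro L
    induction L with
    | nil =>
      intro S hL
      exact (Runs.while_nil hL).congr (by rw [← hL, update_eq_self]; simp [hL])
    | cons a L ih =>
      intro S hL
      have := Runs.while_cons (b := fun a => seq (push r a) (push s a)) hL
        (Runs.seq (Runs.push r a _) (Runs.push s a _)) (ih _ (by simp [hr.symm, hs.symm]))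
      refine Eq.mp ?_ this
      congr 1
      · funext x
        by_cases h₁ : x = s
        · simp [h₁, hrs.symm, hs]
        · by_cases h₂ : x = r
          · simp [h₂, hrs, hr]
          · by_cases h₃ : x = 0 <;>
              simp [h₁, h₂, h₃, hr.symm, hs.symm, update_apply]
      · simp only [List.length_cons]; ring
  refine Eq.mp ?_ (Runs.seq (runs_move hr S) (key _ _ rfl))
  congr 1
  · funext x
    by_cases h₁ : x = s
    · simp [h₁, hrs.symm, hs, h0]
    · by_cases h₂ : x = r
      · simp [h₂, hrs, hr, h0]
      · by_cases h₃ : x = 0 <;> simp [h₁, h₂, h₃, h0, hr.symm, hs.symm, update_apply]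
  · simp only [update_self, h0, List.append_nil, List.length_reverse]; ring

/-- Remove as many symbols from the stack `s` as there are on the stack `r`, and empty `r`. -/
def dropBy (r s : ℕ) : StackProgram A := whilePop r fun _ => pop s

theorem runs_dropBy {r s : ℕ} (hrs : r ≠ s) (S : ℕ → List A) :
    Runs (dropBy r s) S (update (update S r []) s ((S s).drop (S r).length))
      (2 * (S r).length + 1) := by
  generalize hL : S r = L
  induction L generalizing S with
  | nil =>
    exact (Runs.while_nil hL).congr (by rw [← hL, update_eq_self]; simp [hL])
  | cons a L ih =>
    have := Runs.while_cons hL (Runs.pop s _)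
      (ih (update (update S r L) s ((update S r L) s).tail) (by simp [hrs]))
    refine Eq.mp ?_ this
    congr 1
    · funext x
      by_cases h₁ : x = s
      · simp [h₁, hrs.symm]
      · by_cases h₂ : x = r <;> simp [h₁, h₂, hrs, hrs.symm]
    · simp only [List.length_cons]; ring

end StackProgram

/-! ### A language for functions with values in lists -/

/-- Expressions with `n` list variables whose values are lists of symbols. Their values have
polynomial length, and can be computed in polynomial time. -/
inductive Emitter (A : Type) : ℕ → Type
  | nil {n} : Emitter A n
  | sym {n} (a : A) : Emitter A n
  | app {n} (e e' : Emitter A n) : Emitter A n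
  | scan {n} (k : Fin n) (d : A → Bool) (e : A → Emitter A (n + 1)) : Emitter A n
  | bind {n} (e : Emitter A n) (e' : Emitter A (n + 1)) : Emitter A n
  | ite {n} (k : Fin n) (e e' : Emitter A n) : Emitter A n
  | drop {n} (k k' : Fin n) : Emitter A n

/-- The concatenation of the lists `f a acc` for the members `a` of a list, where `acc` consists of
the members since the last one that satisfied `d`, in reverse order. -/
def scanList {A B : Type} (d : A → Bool) (f : A → List A → List B) : List A → List A → List B
  | _, [] => []
  | acc, a :: L => f a acc ++ scanList d f (bif d a then [] else a :: acc) L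

namespace Emitter

open Function StackProgram

variable {A : Type}

/-- Extension of an environment by the value of a new last variable. -/
abbrev extend {α : Type} {n : ℕ} (env : Fin n → α) (x : α) : Fin (n + 1) → α :=
  Fin.snoc (α := fun _ => α) env x

/-- The value of an expression. -/
def eval : {n : ℕ} → Emitter A n → (Fin n → List A) → List A
  | _, nil, _ => []
  | _, sym a, _ => [a]
  | _, app e e', env => e.eval env ++ e'.eval env
  | _, scan k d e, env => scanList d (fun a acc => (e a).eval (extend env acc)) [] (env k)
  | _, bind e e', env => e'.eval (extend env (e.eval env).reverse)
  | _, ite k e e', env => if env k = [] then e.eval env else e'.eval env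
  | _, drop k k', env => (env k).drop (env k').length

/-- The stack that holds the variable of index `i`. -/
def reg (i : ℕ) : ℕ := 4 + 2 * i

/-- The stack from which the loop at level `i` is controlled. -/
def tmp (i : ℕ) : ℕ := 5 + 2 * i

/-- A program that pushes the value of an expression on the stack `o`. The variables are held in the
registers `vars`, and the registers from `lvl` on are free. -/
def compile : {n : ℕ} → Emitter A n → (Fin n → ℕ) → ℕ → ℕ → StackProgram A
  | _, nil, _, _, _ => skip
  | _, sym a, _, _, o => push o a
  | _, app e e', vars, lvl, o => seq (e.compile vars lvl o) (e'.compile vars lvl o)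
  | _, scan k d e, vars, lvl, o =>
    seq (copy (reg (vars k)) (tmp lvl))
      (seq (whilePop (tmp lvl) fun a => seq ((e a).compile (extend vars lvl) (lvl + 1) o)
        (bif d a then clear (reg lvl) else push (reg lvl) a)) (clear (reg lvl)))
  | _, bind e e', vars, lvl, o =>
    seq (e.compile vars (lvl + 1) (reg lvl))
      (seq (e'.compile (extend vars lvl) (lvl + 1) o) (clear (reg lvl)))
  | _, ite k e e', vars, lvl, o =>
    ifEmpty (reg (vars k)) (e.compile vars lvl o) (e'.compile vars lvl o)
  | _, drop k k', vars, _, o =>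
    seq (copy (reg (vars k)) 2) (seq (copy (reg (vars k')) 3) (seq (dropBy 3 2) (move 2 o)))

/-- The stacks represent an environment, and the working stacks are empty. -/
structure Ready {n : ℕ} (S : ℕ → List A) (vars : Fin n → ℕ) (env : Fin n → List A) (lvl : ℕ) :
    Prop where
  regs : ∀ i, S (reg (vars i)) = env i
  lt : ∀ i, vars i < lvl
  zero : S 0 = []
  two : S 2 = []
  three : S 3 = []
  free : ∀ j, lvl ≤ j → S (reg j) = [] ∧ S (tmp j) = []

/-- The stack `o` can be used for the output. -/
def IsTarget {n : ℕ} (o : ℕ) (vars : Fin n → ℕ) (lvl : ℕ) : Prop :=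
  o = 1 ∨ ∃ j < lvl, o = reg j ∧ ∀ i, vars i ≠ j

section

variable {n : ℕ} {S : ℕ → List A} {vars : Fin n → ℕ} {env : Fin n → List A} {lvl o : ℕ}

theorem IsTarget.ne_zero (h : IsTarget o vars lvl) : o ≠ 0 := by
  rcases h with rfl | ⟨j, _, rfl, _⟩ <;> simp [reg]

theorem IsTarget.ne_two (h : IsTarget o vars lvl) : o ≠ 2 := by
  rcases h with rfl | ⟨j, _, rfl, _⟩ <;> simp [reg]; omega

theorem IsTarget.ne_three (h : IsTarget o vars lvl) : o ≠ 3 := by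
  rcases h with rfl | ⟨j, _, rfl, _⟩ <;> simp [reg]; omega

theorem IsTarget.ne_tmp (h : IsTarget o vars lvl) (j : ℕ) : o ≠ tmp j := by
  rcases h with rfl | ⟨j, _, rfl, _⟩ <;> simp only [reg, tmp] <;> omega

theorem IsTarget.ne_reg (h : IsTarget o vars lvl) {j : ℕ} (hj : lvl ≤ j) : o ≠ reg j := by
  rcases h with rfl | ⟨j, _, rfl, _⟩ <;> simp only [reg] <;> omega

theorem IsTarget.ne_var (h : IsTarget o vars lvl) (i : Fin n) : o ≠ reg (vars i) := by
  rcases h with rfl | ⟨j, _, rfl, hj⟩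
  · simp only [reg]; omega
  · have := hj i
    simp only [reg]; omega

theorem IsTarget.extend (h : IsTarget o vars lvl) :
    IsTarget o (Emitter.extend vars lvl) (lvl + 1) := by
  rcases h with rfl | ⟨j, hj, rfl, hv⟩
  · exact Or.inl rfl
  · refine Or.inr ⟨j, by omega, rfl, fun i => ?_⟩
    refine Fin.lastCases ?_ (fun i => ?_) i
    · simp only [Fin.snoc_last]; omega
    · simpa using hv i

theorem Ready.update_target (h : Ready S vars env lvl) (ho : IsTarget o vars lvl) (x : List A) :
    Ready (update S o x) vars env lvl where
  regs i := by rw [update_of_ne (ho.ne_var i).symm, h.regs]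
  lt := h.lt
  zero := by rw [update_of_ne ho.ne_zero.symm, h.zero]
  two := by rw [update_of_ne ho.ne_two.symm, h.two]
  three := by rw [update_of_ne ho.ne_three.symm, h.three]
  free j hj := by
    rw [update_of_ne (ho.ne_reg hj).symm, update_of_ne (ho.ne_tmp j).symm]
    exact h.free j hj

/-- The situation inside a loop at level `lvl`: `reg lvl` has become a variable, and `tmp lvl` is
now allowed to hold the unread symbols. -/
theorem Ready.extend (h : Ready S vars env lvl) (x L : List A) :
    Ready (update (update S (reg lvl) x) (tmp lvl) L) (Emitter.extend vars lvl)
      (Emitter.extend env x) (lvl + 1) where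
  regs i := by
    refine Fin.lastCases ?_ (fun i => ?_) i
    · simp only [Fin.snoc_last]
      rw [update_of_ne (by simp only [reg, tmp]; omega), update_self]
    · simp only [Fin.snoc_castSucc]
      have := h.lt i
      rw [update_of_ne (by simp only [reg, tmp]; omega),
        update_of_ne (by simp only [reg]; omega), h.regs]
  lt i := by
    refine Fin.lastCases ?_ (fun i => ?_) i
    · simp only [Fin.snoc_last]; omega
    · have := h.lt i
      simp only [Fin.snoc_castSucc]; omega
  zero := by
    rw [update_of_ne (by simp only [tmp]; omega), update_of_ne (by simp only [reg]; omega), h.zero]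
  two := by
    rw [update_of_ne (by simp only [tmp]; omega), update_of_ne (by simp only [reg]; omega), h.two]
  three := by
    rw [update_of_ne (by simp only [tmp]; omega), update_of_ne (by simp only [reg]; omega),
      h.three]
  free j hj := by
    rw [update_of_ne (by simp only [reg, tmp]; omega), update_of_ne (by simp only [reg]; omega),
      update_of_ne (by simp only [tmp]; omega), update_of_ne (by simp only [reg, tmp]; omega)]
    exact h.free j (by omega)

/-- The total length of the values of the variables. -/
def envSize (env : Fin n → List A) : ℕ := ∑ i, (env i).length

theorem length_le_envSize (env : Fin n → List A) (i : Fin n) :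
    (env i).length ≤ envSize env :=
  Finset.single_le_sum (f := fun i => (env i).length) (fun _ _ => Nat.zero_le _)
    (Finset.mem_univ i)

theorem envSize_extend (env : Fin n → List A) (x : List A) :
    envSize (Emitter.extend env x) = envSize env + x.length := by
  simp [envSize, Fin.sum_univ_castSucc]

end

/-- The program of `e` is correct, with running time and length of the output bounded by `p`. -/
def BoundedBy {n : ℕ} (e : Emitter A n) (p : Polynomial ℕ) : Prop :=
  ∀ (vars : Fin n → ℕ) (env : Fin n → List A) (lvl o : ℕ) (S : ℕ → List A),
    Ready S vars env lvl → IsTarget o vars lvl →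
      (e.eval env).length ≤ p.eval (envSize env) ∧
        ∃ t ≤ p.eval (envSize env), Runs (e.compile vars lvl o) S
          (update S o ((e.eval env).reverse ++ S o)) t

end Emitter

/-! ### Correctness and running time of compiled expressions -/

namespace Emitter

open Function StackProgram

variable {A : Type}

theorem boundedBy_nil {n : ℕ} : BoundedBy (nil : Emitter A n) 1 := by
  intro vars env lvl o S _ _
  refine ⟨by simp [eval], 1, by simp, (Runs.skip S).congr ?_⟩
  simp [eval]

theorem boundedBy_sym {n : ℕ} (a : A) : BoundedBy (sym a : Emitter A n) 1 := by
  intro vars env lvl o S _ _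
  exact ⟨by simp [eval], 1, by simp, Runs.push o a S⟩

theorem BoundedBy.app {n : ℕ} {e e' : Emitter A n} {p p' : Polynomial ℕ} (h : BoundedBy e p)
    (h' : BoundedBy e' p') : BoundedBy (app e e') (p + p') := by
  intro vars env lvl o S hS ho
  obtain ⟨hl, t, ht, hr⟩ := h vars env lvl o S hS ho
  obtain ⟨hl', t', ht', hr'⟩ := h' vars env lvl o _ (hS.update_target ho _) ho
  refine ⟨by simp [eval]; omega, t + t', by simp; omega, (hr.seq hr').congr ?_⟩
  simp [eval]

theorem BoundedBy.ite {n : ℕ} (k : Fin n) {e e' : Emitter A n} {p p' : Polynomial ℕ}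
    (h : BoundedBy e p) (h' : BoundedBy e' p') : BoundedBy (ite k e e') (p + p' + 1) := by
  intro vars env lvl o S hS ho
  obtain ⟨hl, t, ht, hr⟩ := h vars env lvl o S hS ho
  obtain ⟨hl', t', ht', hr'⟩ := h' vars env lvl o S hS ho
  by_cases hk : env k = []
  · refine ⟨by simp [eval, hk]; omega, 1 + t, by simp; omega, ?_⟩
    simp only [eval, hk, if_true]
    exact Runs.if_nil (by rw [hS.regs, hk]) hr
  · refine ⟨by simp [eval, hk]; omega, 1 + t', by simp; omega, ?_⟩
    simp only [eval, hk, if_false]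
    exact Runs.if_cons (by rwa [hS.regs]) hr'

open Polynomial in
-- Two copies take at most 5N + 2 steps each, the two remaining loops at most 2N + 1 each.
theorem boundedBy_drop {n : ℕ} (k k' : Fin n) :
    BoundedBy (drop k k' : Emitter A n) (14 * X + 6) := by
  intro vars env lvl o S hS ho
  have hk := length_le_envSize env k
  have hk' := length_le_envSize env k'
  have r₁ := runs_copy (r := reg (vars k)) (s := 2) (by simp [reg]) (by simp)
    (by simp [reg]; omega) S hS.zero
  have r₂ := runs_copy (r := reg (vars k')) (s := 3) (by simp [reg]) (by simp)
    (by simp [reg]; omega) (update S 2 (S (reg (vars k)) ++ S 2)) (by simpa using hS.zero)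
  have h₂ : reg (vars k') ≠ 2 := by simp [reg]; omega
  refine ⟨by simp [eval]; omega, _, ?_, (r₁.seq (r₂.seq ((runs_dropBy (by simp) _).seq
    (runs_move ho.ne_two.symm _)))).congr ?_⟩
  · simp [hS.two, hS.three, hS.regs, h₂]
    omega
  · funext x
    simp only [eval, update_self, hS.two, hS.regs, List.append_nil]
    by_cases h₃ : x = o
    · subst h₃
      simp [h₂, ho.ne_two, ho.ne_three, hS.regs, hS.three]
    · by_cases h₄ : x = 2
      · subst h₄; simp [h₃, hS.two]
      · by_cases h₅ : x = 3 <;> simp [h₃, h₄, h₅, hS.three]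
        subst h₅; simp [h₃, hS.three]

open Polynomial in
-- The value of `e` is pushed symbol by symbol, so it is stored in reverse; this is the reason for
-- the reversal in `eval`. The expression `e` is compiled one level higher to keep its loops away
-- from its target `reg lvl`.
theorem BoundedBy.bind {n : ℕ} {e : Emitter A n} {e' : Emitter A (n + 1)} {p p' : Polynomial ℕ}
    (h : BoundedBy e p) (h' : BoundedBy e' p') :
    BoundedBy (bind e e') (p + 2 * p + 1 + p'.comp (X + p)) := by
  intro vars env lvl o S hS ho
  have hS₁ : Ready S vars env (lvl + 1) :=
    ⟨hS.regs, fun i => (hS.lt i).trans (Nat.lt_succ_self _), hS.zero, hS.two, hS.three,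
      fun j hj => hS.free j (by omega)⟩
  obtain ⟨hl, t, ht, hr⟩ := h vars env (lvl + 1) (reg lvl) S hS₁
    (Or.inr ⟨lvl, Nat.lt_succ_self _, rfl, fun i => (hS.lt i).ne⟩)
  rw [(hS.free lvl le_rfl).1, List.append_nil] at hr
  have hS₂ := hS.extend (e.eval env).reverse []
  rw [update_eq_self_iff.2] at hS₂
  swap
  · rw [update_of_ne (by simp only [reg, tmp]; omega), (hS.free lvl le_rfl).2]
  obtain ⟨hl', t', ht', hr'⟩ := h' (extend vars lvl) _ (lvl + 1) o _ hS₂ ho.extend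
  have hc := runs_clear (reg lvl) (update (update S (reg lvl) (e.eval env).reverse) o
    ((e'.eval (extend env (e.eval env).reverse)).reverse ++
      update S (reg lvl) (e.eval env).reverse o))
  have ho' := ho.ne_reg (le_refl lvl)
  have hle := p'.eval_mono_nat (x := envSize (extend env (e.eval env).reverse))
    (y := envSize env + p.eval (envSize env)) (by
      rw [envSize_extend, List.length_reverse]; omega)
  refine ⟨?_, _, ?_, (hr.seq (hr'.seq hc)).congr ?_⟩
  · simp only [eval, eval_add, eval_mul, eval_comp, eval_X, eval_one, eval_ofNat]
    omega
  · simp only [eval_add, eval_mul, eval_comp, eval_X, eval_one, eval_ofNat]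
    rw [update_of_ne ho'.symm, update_self, List.length_reverse]
    omega
  · funext x
    by_cases hx : x = o
    · subst hx
      simp [ho', eval]
    · by_cases hx' : x = reg lvl
      · subst hx'
        simp [hx, (hS.free lvl le_rfl).1]
      · simp [hx, hx']

open Polynomial in
-- The accumulator holds only symbols already read, so each of the at most N rounds runs its body in
-- an environment of size at most 2N. The term `7 * X + 4` pays for the copy, the last loop test and
-- the final clearing.
theorem BoundedBy.scan [Fintype A] {n : ℕ} (k : Fin n) (d : A → Bool) {e : A → Emitter A (n + 1)}
    {p : A → Polynomial ℕ} (h : ∀ a, BoundedBy (e a) (p a)) :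
    BoundedBy (scan k d e) ((X + 1) * ((∑ a, p a).comp (2 * X) + 2 * X + 3) + 7 * X + 4) := by
  intro vars env lvl o S hS ho
  set N := envSize env
  set C := (∑ a, p a).eval (2 * N)
  have hC : ∀ a (acc : List A), acc.length ≤ N → (p a).eval (envSize (extend env acc)) ≤ C := by
    intro a acc hacc
    refine ((p a).eval_mono_nat (y := 2 * N) (by rw [envSize_extend]; omega)).trans ?_
    simp only [C, eval_finsetSum]
    exact Finset.single_le_sum (f := fun a => (p a).eval (2 * N)) (fun _ _ => Nat.zero_le _)
      (Finset.mem_univ a)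
  -- Loop invariant: unread symbols and accumulator together have length at most N.
  have key : ∀ (L acc x : List A), L.length + acc.length ≤ N →
      (scanList d (fun a acc => (e a).eval (extend env acc)) acc L).length ≤ L.length * C ∧
      ∃ acc' : List A, acc'.length ≤ N ∧ ∃ t ≤ L.length * (C + 2 * N + 3) + 1,
        Runs (whilePop (tmp lvl) fun a => seq ((e a).compile (extend vars lvl) (lvl + 1) o)
          (bif d a then clear (reg lvl) else push (reg lvl) a))
          (update (update (update S o x) (reg lvl) acc) (tmp lvl) L)
          (update (update (update S o
            ((scanList d (fun a acc => (e a).eval (extend env acc)) acc L).reverse ++ x))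
              (reg lvl) acc') (tmp lvl) []) t := by
    intro L
    induction L with
    | nil =>
      intro acc x hN
      refine ⟨by simp [scanList], acc, by simpa using hN, 1, by simp, ?_⟩
      simpa [scanList] using Runs.while_nil (by simp)
    | cons a L ih =>
      intro acc x hN
      simp only [List.length_cons] at hN
      have hR := (hS.update_target ho x).extend acc L
      obtain ⟨hl, t, ht, hr⟩ := h a (extend vars lvl) (extend env acc) (lvl + 1) o _ hR ho.extend
      have hCa := hC a acc (by omega)
      set y := ((e a).eval (extend env acc)).reverse ++ x with hy
      have hstate : update (update (update (update S o x) (reg lvl) acc) (tmp lvl) L) o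
          (((e a).eval (extend env acc)).reverse ++
            update (update (update S o x) (reg lvl) acc) (tmp lvl) L o) =
          update (update (update S o y) (reg lvl) acc) (tmp lvl) L := by
        have h₁ := ho.ne_tmp lvl
        have h₂ := ho.ne_reg (le_refl lvl)
        funext z
        by_cases hz : z = o
        · subst hz; simp [h₁, h₂, hy]
        · simp [hz, update_apply]
      rw [hstate] at hr
      have hrt : reg lvl ≠ tmp lvl := by simp only [reg, tmp]; omega
      obtain ⟨u, hu, hr'⟩ : ∃ u ≤ 2 * N + 1, Runs (bif d a then clear (reg lvl)
          else push (reg lvl) a) (update (update (update S o y) (reg lvl) acc) (tmp lvl) L)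
          (update (update (update S o y) (reg lvl) (bif d a then [] else a :: acc))
            (tmp lvl) L) u := by
        cases d a
        · refine ⟨1, by omega, (Runs.push _ a _).congr ?_⟩
          rw [update_of_ne hrt, update_self, update_comm hrt.symm, update_idem]
          rfl
        · refine ⟨_, ?_, (runs_clear (reg lvl) _).congr ?_⟩
          · rw [update_of_ne hrt, update_self]; omega
          · rw [update_comm hrt.symm, update_idem]
            rfl
      obtain ⟨hl', acc', hacc', t', ht', hr''⟩ := ih (bif d a then [] else a :: acc) y (by
        cases d a <;> simp <;> omega)
      refine ⟨?_, acc', hacc', 1 + (t + u) + t', ?_, ?_⟩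
      · simp only [scanList, List.length_append, List.length_cons, Nat.succ_mul]
        omega
      · have : (L.length + 1) * (C + 2 * N + 3) =
            L.length * (C + 2 * N + 3) + (C + 2 * N + 3) := by ring
        rw [List.length_cons, this]
        omega
      · have := Runs.while_cons (r := tmp lvl) (a := a) (L := L)
          (S := update (update (update S o x) (reg lvl) acc) (tmp lvl) (a :: L)) (by simp)
          ((Runs.seq hr hr').congr rfl |> fun h => by rwa [update_idem]) hr''
        simpa [scanList, hy] using this
  have hk := length_le_envSize env k
  have r₁ := runs_copy (r := reg (vars k)) (s := tmp lvl) (by simp [reg]) (by simp [tmp])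
    (by simp only [reg, tmp]; omega) S hS.zero
  rw [(hS.free lvl le_rfl).2, List.append_nil, hS.regs] at r₁
  obtain ⟨hl, acc, hacc, t, ht, r₂⟩ := key (env k) [] (S o) (by simpa using hk)
  rw [update_eq_self, show update S (reg lvl) [] = S from
    update_eq_self_iff.2 (hS.free lvl le_rfl).1.symm] at r₂
  have r₃ := runs_clear (reg lvl) (update (update (update S o
            ((scanList d (fun a acc => (e a).eval (extend env acc)) [] (env k)).reverse ++ S o))
              (reg lvl) acc) (tmp lvl) [])
  have hrt : reg lvl ≠ tmp lvl := by simp only [reg, tmp]; omega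
  have hmul : (env k).length * (C + 2 * N + 3) ≤ N * (C + 2 * N + 3) :=
    Nat.mul_le_mul_right _ hk
  have hmul' : (env k).length * C ≤ N * (C + 2 * N + 3) :=
    Nat.mul_le_mul hk (by omega)
  have heval : ((X + 1) * ((∑ a, p a).comp (2 * X) + 2 * X + 3) + 7 * X + 4 :
      Polynomial ℕ).eval N = N * (C + 2 * N + 3) + (C + 2 * N + 3) + 7 * N + 4 := by
    simp only [eval_add, eval_mul, eval_comp, eval_X, eval_one, eval_ofNat, C]
    ring
  refine ⟨?_, _, ?_, (r₁.seq (r₂.seq r₃)).congr ?_⟩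
  · rw [heval]
    simp only [eval]
    omega
  · rw [heval, update_of_ne hrt, update_self]
    omega
  · have h₁ := ho.ne_tmp lvl
    have h₂ := ho.ne_reg (le_refl lvl)
    funext z
    by_cases hz : z = o
    · subst hz; simp [h₁, h₂, eval]
    · by_cases hz' : z = reg lvl
      · subst hz'; simp [hz, (hS.free lvl le_rfl).1]
      · by_cases hz'' : z = tmp lvl
        · subst hz''; simp [hz, hrt.symm, (hS.free lvl le_rfl).2]
        · simp [hz, hz', hz'']

/-- The nesting of loops is fixed by the expression and each loop runs over a list of polynomial
length, so the bounds compose. -/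
theorem exists_boundedBy [Fintype A] {n : ℕ} (e : Emitter A n) : ∃ p, BoundedBy e p := by
  induction e with
  | nil => exact ⟨1, boundedBy_nil⟩
  | sym a => exact ⟨1, boundedBy_sym a⟩
  | app e e' h h' => exact ⟨_, h.choose_spec.app h'.choose_spec⟩
  | scan k d e h => exact ⟨_, BoundedBy.scan k d fun a => (h a).choose_spec⟩
  | bind e e' h h' => exact ⟨_, h.choose_spec.bind h'.choose_spec⟩
  | ite k e e' h h' => exact ⟨_, BoundedBy.ite k h.choose_spec h'.choose_spec⟩
  | drop k k' => exact ⟨_, boundedBy_drop k k'⟩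

/-- The value of an expression with one variable can be computed in polynomial time. -/
theorem exists_program [Fintype A] (e : Emitter A 1) : ∃ (c : StackProgram A) (p : Polynomial ℕ),
    ∀ s : List A, (e.eval fun _ => s).length ≤ p.eval s.length ∧
      ∃ t ≤ p.eval s.length, Runs c (update (fun _ => []) 4 s)
        (update (fun _ => []) 1 (e.eval fun _ => s).reverse) t := by
  obtain ⟨p, hp⟩ := exists_boundedBy e
  -- The input is variable `0`, on stack `4 = reg 0`. It is cleared because a machine run afterwards
  -- needs all other stacks empty.
  refine ⟨seq (e.compile (fun _ => 0) 1 1) (clear 4), p + (2 * Polynomial.X + 1), fun s => ?_⟩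
  have hsize : envSize (fun _ : Fin 1 => s) = s.length := by simp [envSize]
  obtain ⟨hl, t, ht, hr⟩ := hp (fun _ => 0) (fun _ => s) 1 1 (update (fun _ => []) 4 s)
    ⟨fun _ => by simp [reg], fun _ => Nat.one_pos, by simp, by simp, by simp, fun j hj =>
      ⟨by rw [update_of_ne (by simp only [reg]; omega)],
        by rw [update_of_ne (by simp only [tmp]; omega)]⟩⟩ (Or.inl rfl)
  rw [hsize] at hl ht
  have hc := runs_clear 4 (update (update (fun _ => []) 4 s) 1
    ((e.eval fun _ => s).reverse ++ update (fun _ => []) 4 s 1))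
  refine ⟨by simp only [Polynomial.eval_add]; omega, _, ?_, (hr.seq hc).congr ?_⟩
  · simp
    omega
  · funext x
    by_cases hx : x = 1
    · simp [hx]
    · by_cases hx' : x = 4 <;> simp [hx, hx']

end Emitter

/-! ### Renaming and substitution in expressions -/

namespace Emitter

variable {A : Type}

/-- Renaming of the variables of an expression. -/
def rename : {n m : ℕ} → (Fin n → Fin m) → Emitter A n → Emitter A m
  | _, _, _, nil => nil
  | _, _, _, sym a => sym a
  | _, _, ρ, app e e' => app (e.rename ρ) (e'.rename ρ)
  | _, m, ρ, scan k d e =>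
    scan (ρ k) d fun a => (e a).rename (extend (fun i => (ρ i).castSucc) (Fin.last m))
  | _, m, ρ, bind e e' =>
    bind (e.rename ρ) (e'.rename (extend (fun i => (ρ i).castSucc) (Fin.last m)))
  | _, _, ρ, ite k e e' => ite (ρ k) (e.rename ρ) (e'.rename ρ)
  | _, _, ρ, drop k k' => drop (ρ k) (ρ k')

theorem extend_comp {α : Type} {n m : ℕ} (env : Fin m → α) (ρ : Fin n → Fin m) (x : α) :
    (fun i => extend env x (extend (fun i => (ρ i).castSucc) (Fin.last m) i)) =
      extend (fun i => env (ρ i)) x := by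
  funext i
  refine Fin.lastCases ?_ (fun i => ?_) i <;> simp

theorem eval_rename {n m : ℕ} (ρ : Fin n → Fin m) (e : Emitter A n) (env : Fin m → List A) :
    (e.rename ρ).eval env = e.eval fun i => env (ρ i) := by
  induction e generalizing m with
  | nil => rfl
  | sym a => rfl
  | app e e' h h' => simp [rename, eval, h, h']
  | scan k d e h => simp [rename, eval, h, extend_comp]
  | bind e e' h h' => simp [rename, eval, h, h', extend_comp]
  | ite k e e' h h' => simp [rename, eval, h, h']
  | drop k k' => rfl

theorem scanList_sym {A : Type} (acc L : List A) :
    scanList (fun _ => true) (fun a _ => [a]) acc L = L := by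
  induction L generalizing acc with
  | nil => rfl
  | cons a L ih => simp [scanList, ih]

/-- A variable as an expression. -/
def var {n : ℕ} (k : Fin n) : Emitter A n := scan k (fun _ => true) fun a => sym a

@[simp] theorem eval_var {n : ℕ} (k : Fin n) (env : Fin n → List A) : (var k).eval env = env k :=
  scanList_sym [] (env k)

/-- Variant of `Emitter.bind` that does not reverse the value of the new variable. -/
def letIn {n : ℕ} (e : Emitter A n) (e' : Emitter A (n + 1)) : Emitter A n :=
  bind e (bind (var (Fin.last n))
    (e'.rename (extend (fun i => i.castSucc.castSucc) (Fin.last (n + 1)))))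

-- The second `bind` undoes the reversal caused by the first.
@[simp] theorem eval_letIn {n : ℕ} (e : Emitter A n) (e' : Emitter A (n + 1))
    (env : Fin n → List A) : (letIn e e').eval env = e'.eval (extend env (e.eval env)) := by
  simp only [letIn, eval, eval_rename, eval_var]
  congr 1
  funext i
  refine Fin.lastCases ?_ (fun i => ?_) i <;> simp

theorem append_eq_extend {α : Type} {n m : ℕ} (f : Fin n → α) (g : Fin (m + 1) → α) :
    Fin.append f g = extend (Fin.append f fun i => g i.castSucc) (g (Fin.last m)) := by
  funext i
  refine Fin.lastCases (n := n + m) ?_ (fun i => ?_) i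
  · refine Eq.trans ?_ (Fin.snoc_last (α := fun _ => α) _ _).symm
    exact Fin.append_right f g (Fin.last m)
  · refine Eq.trans ?_ (Fin.snoc_castSucc (α := fun _ => α) _ _ _).symm
    refine Fin.addCases (fun i => ?_) (fun i => ?_) i
    · exact (Fin.append_left f g i).trans (Fin.append_left f _ i).symm
    · exact (Fin.append_right f g i.castSucc).trans (Fin.append_right f (fun i => g i.castSucc) i).symm

theorem exists_letIn {n m : ℕ} (es : Fin m → Emitter A n) (e : Emitter A (n + m)) :
    ∃ e' : Emitter A n, ∀ env,
      e'.eval env = e.eval (Fin.append env fun i => (es i).eval env) := by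
  induction m with
  | zero =>
    refine ⟨e, fun env => congrArg _ ?_⟩
    funext i
    exact (Fin.append_left env _ i).symm
  | succ m ih =>
    obtain ⟨e', he'⟩ := ih (fun i => es i.castSucc)
      (letIn ((es (Fin.last m)).rename (Fin.castAdd m)) e)
    refine ⟨e', fun env => ?_⟩
    rw [he', eval_letIn, eval_rename, append_eq_extend env]
    simp

/-- The values of `es` become new variables behind the old ones, and `e` is renamed to read only the
new ones. This gives closure of `Computes` under composition. -/
theorem exists_subst {n m : ℕ} (es : Fin m → Emitter A n) (e : Emitter A m) :
    ∃ e' : Emitter A n, ∀ env, e'.eval env = e.eval fun i => (es i).eval env := by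
  obtain ⟨e', he'⟩ := exists_letIn es (e.rename (Fin.natAdd n))
  exact ⟨e', fun env => by simp [he', eval_rename]⟩

end Emitter

/-! ### Functions that can be computed in polynomial time -/

/-- A representation of the elements of a type by tuples of strings. -/
class StringRep (α : Type) where
  arity : ℕ
  rep : α → Fin arity → List InputSymbol

/-- A representation of lists by strings, compatible with concatenation. -/
class ListRep (β : Type) where
  enc : List β → List InputSymbol
  enc_nil : enc [] = []
  enc_append : ∀ l l', enc (l ++ l') = enc l ++ enc l'

open StringRep ListRep Emitter

/-- Compatibility of the encoding with concatenation lets a scan emit the code of its result piece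
by piece. -/
theorem ListRep.enc_scanList {β : Type} [ListRep β] (d : InputSymbol → Bool)
    (f : InputSymbol → List InputSymbol → List β) (acc L : List InputSymbol) :
    enc (scanList d f acc L) = scanList d (fun s acc => enc (f s acc)) acc L := by
  induction L generalizing acc with
  | nil => simp [scanList, enc_nil]
  | cons a L ih => simp [scanList, enc_append, ih]

instance : ListRep InputSymbol := ⟨id, rfl, fun _ _ => rfl⟩

instance : ListRep Literal := ⟨fun l => l.flatMap Literal.encode, rfl, fun _ _ => by simp⟩

instance : ListRep (List Literal) := ⟨fun l => l.flatMap Clause.encode, rfl, fun _ _ => by simp⟩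

instance : ListRep Quantifier := ⟨fun l => l.map Quantifier.encode, rfl, fun _ _ => by simp⟩

instance {β : Type} [ListRep β] : StringRep (List β) := ⟨1, fun l _ => enc l⟩

instance : StringRep ℕ := ⟨1, fun n _ => List.replicate n InputSymbol.tick⟩

instance : StringRep Bool := ⟨1, fun b _ => bif b then [InputSymbol.tick] else []⟩

instance {α β : Type} [StringRep α] [StringRep β] : StringRep (α × β) :=
  ⟨arity α + arity β, fun p => Fin.append (rep p.1) (rep p.2)⟩

instance {d : ℕ} : StringRep (SATInstance d) := ⟨1, fun φ _ => φ.encode⟩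

/-- The components of the representation of `f a` are given by expressions in the components of the
representation of `a`. -/
@[fun_prop]
def Computes {α β : Type} [StringRep α] [StringRep β] (f : α → β) : Prop :=
  ∀ i, ∃ e : Emitter InputSymbol (arity α), ∀ a, e.eval (rep a) = rep (f a) i

namespace Computes

variable {α β γ : Type} [StringRep α] [StringRep β] [StringRep γ]

@[fun_prop]
theorem id : Computes fun a : α => a := fun i => ⟨var i, fun a => by simp⟩

@[fun_prop]
theorem const (b : β) : Computes fun _ : α => b := by
  intro i
  suffices ∀ l : List InputSymbol, ∃ e : Emitter InputSymbol (arity α),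
      ∀ a : α, e.eval (rep a) = l from this _
  intro l
  induction l with
  | nil => exact ⟨nil, fun _ => rfl⟩
  | cons s l ih =>
    obtain ⟨e, he⟩ := ih
    exact ⟨app (sym s) e, fun a => by simp [eval, he]⟩

@[fun_prop]
theorem comp {g : β → γ} {f : α → β} (hg : Computes g) (hf : Computes f) :
    Computes fun a => g (f a) := by
  intro i
  obtain ⟨e, he⟩ := hg i
  choose es hes using hf
  obtain ⟨e', he'⟩ := exists_subst es e
  exact ⟨e', fun a => by rw [he', ← he]; simp only [hes]⟩

@[fun_prop]
theorem prodMk {f : α → β} {g : α → γ} (hf : Computes f) (hg : Computes g) :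
    Computes fun a => (f a, g a) := by
  intro i
  refine Fin.addCases (fun i => ?_) (fun i => ?_) i
  · obtain ⟨e, he⟩ := hf i
    exact ⟨e, fun a => by simp only [he, rep, Fin.append_left]⟩
  · obtain ⟨e, he⟩ := hg i
    exact ⟨e, fun a => by simp only [he, rep, Fin.append_right]⟩

@[fun_prop]
theorem fst {f : α → β × γ} (hf : Computes f) : Computes fun a => (f a).1 := by
  intro i
  obtain ⟨e, he⟩ := hf (Fin.castAdd _ i)
  exact ⟨e, fun a => by simp only [he, rep, Fin.append_left]⟩

@[fun_prop]
theorem snd {f : α → β × γ} (hf : Computes f) : Computes fun a => (f a).2 := by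
  intro i
  obtain ⟨e, he⟩ := hf (Fin.natAdd _ i)
  exact ⟨e, fun a => by simp only [he, rep, Fin.append_right]⟩

@[fun_prop]
theorem append {β : Type} [ListRep β] {f g : α → List β} (hf : Computes f) (hg : Computes g) :
    Computes fun a => f a ++ g a := by
  intro i
  obtain ⟨e, he⟩ := hf i
  obtain ⟨e', he'⟩ := hg i
  exact ⟨app e e', fun a => by simp only [eval, he, he', rep, enc_append]⟩

@[fun_prop]
theorem add {f g : α → ℕ} (hf : Computes f) (hg : Computes g) : Computes fun a => f a + g a := by
  intro i
  obtain ⟨e, he⟩ := hf i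
  obtain ⟨e', he'⟩ := hg i
  exact ⟨app e e', fun a => by simp only [eval, he, he', rep, List.replicate_append_replicate]⟩

@[fun_prop]
theorem sub {f g : α → ℕ} (hf : Computes f) (hg : Computes g) : Computes fun a => f a - g a := by
  have : Computes fun p : ℕ × ℕ => p.1 - p.2 := fun i =>
    ⟨drop (0 : Fin 2) (1 : Fin 2), fun a => by
      change List.drop (List.replicate a.2 InputSymbol.tick).length
        (List.replicate a.1 InputSymbol.tick) = List.replicate (a.1 - a.2) InputSymbol.tick
      simp⟩
  exact this.comp (hf.prodMk hg)

@[fun_prop]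
theorem cond {b : α → Bool} {f g : α → β} (hb : Computes b) (hf : Computes f) (hg : Computes g) :
    Computes fun a => bif b a then f a else g a := by
  intro i
  obtain ⟨eb, heb⟩ := hb 0
  obtain ⟨e, he⟩ := hf i
  obtain ⟨e', he'⟩ := hg i
  -- The empty string represents `false`, so the branch for emptiness is `g`.
  refine ⟨bind eb (ite (Fin.last _) (e'.rename Fin.castSucc) (e.rename Fin.castSucc)),
    fun a => ?_⟩
  cases h : b a <;> simp [eval, eval_rename, he, he', heb, rep, h]

theorem isZero : Computes fun n : ℕ => decide (n = 0) := fun i =>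
  ⟨ite (0 : Fin 1) (sym InputSymbol.tick) nil, fun n => by
    by_cases h : n = 0 <;> simp [eval, rep, h]⟩

@[fun_prop]
theorem not {f : α → Bool} (hf : Computes f) : Computes fun a => !f a := by
  have : (fun a => !f a) = fun a => bif f a then false else true := by
    funext a; cases f a <;> rfl
  rw [this]
  fun_prop

@[fun_prop]
theorem and {f g : α → Bool} (hf : Computes f) (hg : Computes g) :
    Computes fun a => f a && g a := by
  have : (fun a => f a && g a) = fun a => bif f a then g a else false := by
    funext a; cases f a <;> rfl
  rw [this]
  fun_prop

@[fun_prop]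
theorem or {f g : α → Bool} (hf : Computes f) (hg : Computes g) :
    Computes fun a => f a || g a := by
  have : (fun a => f a || g a) = fun a => bif f a then true else g a := by
    funext a; cases f a <;> rfl
  rw [this]
  fun_prop

-- Numbers are equal when both truncated differences vanish.
@[fun_prop]
theorem decide_eq {f g : α → ℕ} (hf : Computes f) (hg : Computes g) :
    Computes fun a => decide (f a = g a) := by
  have : (fun a => decide (f a = g a)) = fun a => decide ((f a - g a) + (g a - f a) = 0) := by
    funext a
    congr 1
    apply propext
    omega
  rw [this]
  exact isZero.comp (by fun_prop)

theorem scan {β : Type} [ListRep β] {src : α → List InputSymbol} (d : InputSymbol → Bool)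
    {F : InputSymbol → α → List InputSymbol → List β} (hsrc : Computes src)
    (hF : ∀ s, Computes fun p : α × List InputSymbol => F s p.1 p.2) :
    Computes fun a => scanList d (fun s acc => F s a acc) [] (src a) := by
  intro i
  obtain ⟨e, he⟩ := hsrc 0
  choose es hes using fun s => hF s 0
  refine ⟨letIn e (Emitter.scan (Fin.last _) d fun s =>
    (es s).rename (extend (fun i => i.castSucc.castSucc) (Fin.last (arity α + 1)))),
    fun a => ?_⟩
  rw [eval_letIn, eval, he]
  simp only [rep]
  have hlast : extend (rep a) (enc (src a)) (Fin.last (arity α)) = src a :=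
    Fin.snoc_last (α := fun _ => List InputSymbol) _ _
  rw [enc_scanList, hlast]
  congr 1
  funext s acc
  rw [eval_rename]
  refine Eq.trans (congrArg _ ?_) (hes s (a, acc))
  funext i
  refine Fin.addCases (fun i => ?_) (fun i => ?_) i
  · refine Eq.trans ?_ (Fin.append_left (rep a) (rep acc) i).symm
    change extend _ _ (extend _ _ i.castSucc) = _
    simp
  · refine Eq.trans ?_ (Fin.append_right (rep a) (rep acc) i).symm
    have : i = 0 := Subsingleton.elim (α := Fin 1) _ _
    subst this
    change extend _ _ (extend _ _ (Fin.last _)) = _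
    simp
    rfl

theorem _root_.scanList_replicate {A B : Type} (t : A) (F : A → List A → List B) (m j : ℕ) :
    scanList (fun _ => false) F (List.replicate j t) (List.replicate m t) =
      (List.range' j m).flatMap fun i => F t (List.replicate i t) := by
  induction m generalizing j with
  | zero => rfl
  | succ m ih =>
    rw [List.replicate_succ, scanList, cond_false, ← List.replicate_succ, ih, List.range'_succ]
    simp

/-- A number as a string. -/
theorem ticks : Computes fun n : ℕ => List.replicate n InputSymbol.tick := fun _ =>
  ⟨var (0 : Fin 1), fun n => by simp [rep, enc]⟩

theorem length : Computes fun l : List InputSymbol => l.length := by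
  have h : Computes fun l : List InputSymbol =>
      scanList (fun _ => true) (fun _ _ => [InputSymbol.tick]) [] l :=
    scan (F := fun _ _ _ => [InputSymbol.tick]) (fun _ => true) id fun _ => const _
  intro i
  obtain ⟨e, he⟩ := h 0
  refine ⟨e, fun l => (he l).trans ?_⟩
  have : ∀ acc l : List InputSymbol, scanList (fun _ => true)
      (fun _ _ => [InputSymbol.tick]) acc l = List.replicate l.length InputSymbol.tick := by
    intro acc l
    induction l generalizing acc with
    | nil => rfl
    | cons s l ih => simp [scanList, ih, List.replicate_succ]
  exact this [] l

-- A number is a string of ticks. In a scan of it that never resets, the accumulator consists of j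
-- ticks in round j and thus serves as the loop index.
@[fun_prop]
theorem flatMap_range {β : Type} [ListRep β] {f : α → ℕ → List β} {g : α → ℕ}
    (hf : Computes fun p : α × ℕ => f p.1 p.2) (hg : Computes g) :
    Computes fun a => (List.range (g a)).flatMap fun j => f a j := by
  have hF : Computes fun p : α × List InputSymbol => f p.1 p.2.length :=
    hf.comp (id.fst.prodMk (length.comp id.snd))
  convert scan (F := fun _ a acc => f a acc.length) (fun _ => false) (ticks.comp hg)
    (fun _ => hF) using 2 with a
  refine Eq.trans ?_ (scanList_replicate InputSymbol.tick
    (fun _ acc => f a acc.length) (g a) 0).symm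
  simp [List.range_eq_range']

@[fun_prop]
theorem sum_range {f : α → ℕ → ℕ} {g : α → ℕ}
    (hf : Computes fun p : α × ℕ => f p.1 p.2) (hg : Computes g) :
    Computes fun a => ∑ j ∈ Finset.range (g a), f a j := by
  have h : Computes fun a => (List.range (g a)).flatMap fun j =>
      List.replicate (f a j) InputSymbol.tick :=
    flatMap_range (ticks.comp hf) hg
  convert length.comp h using 2 with a
  induction g a with
  | zero => simp
  | succ n ih => rw [Finset.sum_range_succ, List.range_succ, List.flatMap_append]; simp [ih]

@[fun_prop]
theorem mul {f g : α → ℕ} (hf : Computes f) (hg : Computes g) : Computes fun a => f a * g a := by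
  have : Computes fun a => ∑ j ∈ Finset.range (f a), g a := by fun_prop
  simpa using this

@[fun_prop]
theorem literal {v : α → ℕ} (b : Bool) (hv : Computes v) :
    Computes fun a => [(⟨v a, b⟩ : Literal)] := by
  intro i
  obtain ⟨e, he⟩ := hv 0
  cases b
  · exact ⟨app (sym InputSymbol.neg) e, fun a => by
      simp [eval, he, rep, enc, Literal.encode]⟩
  · exact ⟨app (sym InputSymbol.pos) e, fun a => by
      simp [eval, he, rep, enc, Literal.encode]⟩

theorem clause {C : α → List Literal} (hC : Computes C) : Computes fun a => [C a] := by
  intro i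
  obtain ⟨e, he⟩ := hC 0
  exact ⟨app e (sym InputSymbol.sep), fun a => by simp [eval, he, rep, enc, Clause.encode]⟩

theorem replicate {n : α → ℕ} (q : Quantifier) (hn : Computes n) :
    Computes fun a => List.replicate (n a) q := by
  have h : Computes fun a => (List.range (n a)).flatMap fun _ => [q] := by fun_prop
  convert h using 2 with a
  induction n a with
  | zero => rfl
  | succ m ih => rw [List.range_succ, List.flatMap_append, ← ih, List.replicate_succ']; simp

end Computes

open StringRep ListRep Emitter

/-! ### Reading the input -/

theorem scanList_append_of_skip {A B : Type} {d : A → Bool} {f : A → List A → List B} {L : List A}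
    (hd : ∀ s ∈ L, d s = false) (hf : ∀ s ∈ L, ∀ acc, f s acc = []) (acc R : List A) :
    scanList d f acc (L ++ R) = scanList d f (L.reverse ++ acc) R := by
  induction L generalizing acc with
  | nil => rfl
  | cons s L ih =>
    simp only [List.mem_cons, forall_eq_or_imp] at hd hf
    simp [scanList, hd.1, hf.1, ih hd.2 hf.2]

theorem scanList_eq_nil {A B : Type} {d : A → Bool} {f : A → List A → List B} {L : List A}
    (hd : ∀ s ∈ L, d s = false) (hf : ∀ s ∈ L, ∀ acc, f s acc = []) (acc : List A) :
    scanList d f acc L = [] := by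
  simpa [scanList] using scanList_append_of_skip hd hf acc []

/-- This separates the unary number of variables from the formula behind it. -/
theorem CNF.encode_head (ψ : CNF) : ψ.encode.head? ≠ some InputSymbol.tick := by
  rcases ψ with _ | ⟨C, ψ⟩
  · simp [CNF.encode]
  · rcases C with _ | ⟨l, C⟩
    · simp [CNF.encode, Clause.encode]
    · by_cases h : l.positive <;> simp [CNF.encode, Clause.encode, Literal.encode, h]

/-- The code of a literal as a number. -/
def Literal.code (l : Literal) : ℕ := 2 * l.var + if l.positive then 0 else 1

/-- All literals of some clause of the formula have their codes among `a`, `b` and `c`. -/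
def CNF.covers (ψ : CNF) (a b c : ℕ) : Bool :=
  ψ.any fun C => C.all fun l => decide (l.code = a) || decide (l.code = b) || decide (l.code = c)

namespace Computes

variable {α : Type} [StringRep α]

theorem countP (P : InputSymbol → Bool) : Computes fun l : List InputSymbol => l.countP P := by
  have h : Computes fun l : List InputSymbol => scanList (fun _ => true)
      (fun s _ => bif P s then [InputSymbol.tick] else []) [] l :=
    scan (F := fun s _ _ => bif P s then [InputSymbol.tick] else []) (fun _ => true) id
      fun _ => const _
  have key : ∀ acc l : List InputSymbol, (scanList (fun _ => true)
      (fun s _ => bif P s then [InputSymbol.tick] else []) acc l).length = l.countP P := by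
    intro acc l
    induction l generalizing acc with
    | nil => rfl
    | cons s l ih => cases hs : P s <;> simp [scanList, ih, hs]
  exact (congrArg Computes (funext fun l => key [] l)).mp (length.comp h)

theorem encode {d : ℕ} : Computes fun φ : SATInstance d => φ.encode := fun _ =>
  ⟨var (0 : Fin 1), fun φ => by simp [rep, enc]⟩

/-- The ticks to be counted are those with nothing but ticks before them. -/
theorem numVars {d : ℕ} : Computes fun φ : SATInstance d => φ.numVars := by
  set F : InputSymbol → List InputSymbol → List InputSymbol := fun s acc =>
    bif decide (s = InputSymbol.tick) then
      bif decide (acc.countP (fun s => decide (s ≠ InputSymbol.tick)) = 0)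
        then [InputSymbol.tick] else []
    else [] with hF
  have h : Computes fun φ : SATInstance d => scanList (fun _ => false) F [] φ.encode := by
    refine scan (F := fun s _ acc => F s acc) (fun _ => false) encode fun s => ?_
    have := countP fun s => decide (s ≠ InputSymbol.tick)
    simp only [hF]
    fun_prop
  have h₁ : ∀ (L acc : List InputSymbol), (∃ s ∈ acc, s ≠ InputSymbol.tick) →
      scanList (fun _ => false) F acc L = [] := by
    intro L
    induction L with
    | nil => intro _ _; rfl
    | cons s L ih =>
      rintro acc ⟨x, hx, hx'⟩
      rw [scanList, cond_false, ih _ ⟨x, List.mem_cons_of_mem _ hx, hx'⟩]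
      have : acc.countP (fun s => decide (s ≠ InputSymbol.tick)) ≠ 0 := by
        rw [← Nat.pos_iff_ne_zero, List.countP_pos_iff]
        exact ⟨x, hx, by simpa using hx'⟩
      simp only [hF]
      rw [show decide (acc.countP (fun s => decide (s ≠ InputSymbol.tick)) = 0) = false from
        decide_eq_false this]
      cases decide (s = InputSymbol.tick) <;> rfl
  have h₂ : ∀ (R : List InputSymbol) (m j : ℕ), R.head? ≠ some InputSymbol.tick →
      (scanList (fun _ => false) F (List.replicate j InputSymbol.tick)
        (List.replicate m InputSymbol.tick ++ R)).length = m := by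
    intro R m
    induction m with
    | zero =>
      intro j hR
      rcases R with _ | ⟨s, R⟩
      · rfl
      · have hs : s ≠ InputSymbol.tick := by simpa using hR
        rw [List.replicate_zero, List.nil_append, scanList, cond_false,
          h₁ R _ ⟨s, List.mem_cons_self, hs⟩]
        simp [hF, hs]
    | succ m ih =>
      intro j hR
      rw [List.replicate_succ, List.cons_append, scanList, cond_false, ← List.replicate_succ,
        List.length_append, ih _ hR]
      simp [hF, add_comm]
  convert length.comp h using 2 with φ
  exact (h₂ _ φ.numVars 0 φ.formula.encode_head).symm

/-- The number of literals, in a reversed string, whose code is not among `a`, `b` and `c`. -/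
def uncovered (a b c : ℕ) (s : List InputSymbol) : ℕ :=
  (scanList (fun s => decide (s = InputSymbol.pos) || decide (s = InputSymbol.neg))
    (fun s t =>
      bif decide (s = InputSymbol.pos) || decide (s = InputSymbol.neg) then
        bif decide (2 * t.length + (bif decide (s = InputSymbol.pos) then 0 else 1) = a) ||
            decide (2 * t.length + (bif decide (s = InputSymbol.pos) then 0 else 1) = b) ||
            decide (2 * t.length + (bif decide (s = InputSymbol.pos) then 0 else 1) = c)
          then [] else [InputSymbol.tick]
      else []) [] s).length

/-- Read backwards, a literal is its ticks followed by its sign, so at the sign the accumulator is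
exactly the index of the variable. The final `n` ticks, which stand before the first clause of the
input, are followed by no sign and have no effect. -/
theorem uncovered_eq_zero (a b c n : ℕ) (C : Clause) :
    uncovered a b c ((C.flatMap Literal.encode).reverse ++ List.replicate n InputSymbol.tick) = 0 ↔
      C.all fun l => decide (l.code = a) || decide (l.code = b) || decide (l.code = c) := by
  induction C using List.reverseRecOn with
  | nil =>
    simp only [List.flatMap_nil, List.reverse_nil, List.nil_append, List.all_nil, iff_true]
    rw [uncovered, scanList_eq_nil]
    · rfl
    · intro s hs; simp [List.eq_of_mem_replicate hs]
    · intro s hs acc; simp [List.eq_of_mem_replicate hs]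
  | append_singleton C l ih =>
    rw [List.flatMap_append, List.reverse_append, List.flatMap_singleton, Literal.encode,
      List.reverse_cons, List.reverse_replicate, List.append_assoc, List.append_assoc, uncovered,
      scanList_append_of_skip]
    · rw [List.all_append, Bool.and_eq_true, ← ih, uncovered, List.singleton_append, scanList,
        List.length_append]
      by_cases h' : l.code = a ∨ l.code = b ∨ l.code = c
      · cases h : l.positive <;> simp [h, Literal.code] at h' ⊢ <;>
          rcases h' with h' | h' | h' <;> simp [h']
      · cases h : l.positive <;> simp [h, Literal.code] at h' ⊢ <;> simp [h']
    · intro s hs; simp [List.eq_of_mem_replicate hs]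
    · intro s hs acc; simp [List.eq_of_mem_replicate hs]

@[fun_prop]
theorem uncovered' {a b c : α → ℕ} {s : α → List InputSymbol} (ha : Computes a) (hb : Computes b)
    (hc : Computes c) (hs : Computes s) :
    Computes fun x => uncovered (a x) (b x) (c x) (s x) := by
  refine length.comp (scan (F := fun s x t =>
      bif decide (s = InputSymbol.pos) || decide (s = InputSymbol.neg) then
        bif decide (2 * t.length + (bif decide (s = InputSymbol.pos) then 0 else 1) = a x) ||
            decide (2 * t.length + (bif decide (s = InputSymbol.pos) then 0 else 1) = b x) ||
            decide (2 * t.length + (bif decide (s = InputSymbol.pos) then 0 else 1) = c x)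
          then [] else [InputSymbol.tick]
      else []) _ hs fun s => ?_)
  have := length
  fun_prop

/-- The scan resets at separators, so at each separator the accumulator is the clause just read, in
reverse. -/
theorem covers {d : ℕ} {φ : α → SATInstance d} {a b c : α → ℕ} (hφ : Computes φ)
    (ha : Computes a) (hb : Computes b) (hc : Computes c) :
    Computes fun x => (φ x).formula.covers (a x) (b x) (c x) := by
  have h : Computes fun x => scanList (fun s => decide (s = InputSymbol.sep))
      (fun s acc => bif decide (s = InputSymbol.sep) then
        bif decide (uncovered (a x) (b x) (c x) acc = 0) then [InputSymbol.tick] else []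
        else []) [] (φ x).encode := by
    refine scan (F := fun s x acc => bif decide (s = InputSymbol.sep) then
        bif decide (uncovered (a x) (b x) (c x) acc = 0) then [InputSymbol.tick] else []
        else []) _ (encode.comp hφ) fun s => ?_
    fun_prop
  have key : ∀ (a b c : ℕ) (ψ : CNF) (n : ℕ),
      scanList (fun s => decide (s = InputSymbol.sep))
        (fun s acc => bif decide (s = InputSymbol.sep) then
          bif decide (uncovered a b c acc = 0) then [InputSymbol.tick] else []
          else []) (List.replicate n InputSymbol.tick) ψ.encode = [] ↔ ¬ ψ.covers a b c := by
    intro a b c ψ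
    induction ψ with
    | nil => intro n; simp [CNF.encode, scanList, CNF.covers]
    | cons C ψ ih =>
      intro n
      have hne : ∀ s ∈ C.flatMap Literal.encode, s ≠ InputSymbol.sep := by
        intro s hs
        simp only [List.mem_flatMap, Literal.encode] at hs
        obtain ⟨l, _, hl⟩ := hs
        rcases List.mem_cons.1 hl with rfl | hl
        · split_ifs <;> simp
        · simp [List.eq_of_mem_replicate hl]
      rw [CNF.encode, List.flatMap_cons, Clause.encode, List.append_assoc,
        scanList_append_of_skip]
      · have := ih 0
        rw [CNF.encode, List.replicate_zero] at this
        rw [List.singleton_append, scanList, List.append_eq_nil_iff]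
        simp only [decide_true, cond_true]
        have hcov : CNF.covers (C :: ψ) a b c = ((C.all fun l =>
            decide (l.code = a) || decide (l.code = b) || decide (l.code = c)) ||
            CNF.covers ψ a b c) := rfl
        rw [this, hcov, Bool.or_eq_true, not_or, ← uncovered_eq_zero a b c n]
        refine and_congr_left fun _ => ?_
        by_cases h : uncovered a b c ((C.flatMap Literal.encode).reverse ++
          List.replicate n InputSymbol.tick) = 0 <;> simp [h]
      · intro s hs; simp [hne s hs]
      · intro s hs acc; simp [hne s hs]
  have h' : Computes fun x => !decide ((scanList (fun s => decide (s = InputSymbol.sep))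
      (fun s acc => bif decide (s = InputSymbol.sep) then
        bif decide (uncovered (a x) (b x) (c x) acc = 0) then [InputSymbol.tick] else []
        else []) [] (φ x).encode).length = 0) :=
    (decide_eq (length.comp h) (const 0)).not
  convert h' using 2 with x
  have := key (a x) (b x) (c x) (φ x).formula (φ x).numVars
  rw [SATInstance.encode, scanList_append_of_skip]
  · rw [List.reverse_replicate, List.append_nil, Bool.eq_iff_iff, Bool.not_eq_true',
      decide_eq_false_iff_not, List.length_eq_zero_iff, this, not_not]
  · intro s hs; simp [List.eq_of_mem_replicate hs]
  · intro s hs acc; simp [List.eq_of_mem_replicate hs]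

end Computes

/-! ### Logarithms and iterated powers -/

/-- A positive number is a power of two exactly when it has no odd divisor from 3 on. Divisor and
cofactor are at most n, so bounded sums can search for them. -/
theorem isPowerOfTwo_iff (n : ℕ) : (∃ k, n = 2 ^ k) ↔
    n ≠ 0 ∧ ∑ a ∈ Finset.range n, ∑ b ∈ Finset.range n,
      (bif decide ((2 * a + 3) * (b + 1) = n) then 1 else 0) = 0 := by
  constructor
  · rintro ⟨k, rfl⟩
    refine ⟨by positivity, Finset.sum_eq_zero fun a _ => Finset.sum_eq_zero fun b _ => ?_⟩
    have : (2 * a + 3) * (b + 1) ≠ 2 ^ k := by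
      intro h
      obtain ⟨j, _, hj⟩ := (Nat.dvd_prime_pow Nat.prime_two).1 (Dvd.intro _ h)
      rcases j with _ | j
      · simp at hj
      · rw [pow_succ] at hj; omega
    simp [this]
  · rintro ⟨hn, h⟩
    rcases Nat.eq_two_pow_or_exists_odd_prime_and_dvd n with h' | ⟨p, hp, ⟨q, rfl⟩, hodd⟩
    · exact h'
    · exfalso
      obtain ⟨m, rfl⟩ := hodd
      have hm : m ≠ 0 := by rintro rfl; exact absurd hp (by norm_num)
      have hq : q ≠ 0 := by rintro rfl; simp at hn
      have hq₁ : (2 * m + 1) * 1 ≤ (2 * m + 1) * q := Nat.mul_le_mul_left _ (by omega)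
      have hq₂ : 1 * q ≤ (2 * m + 1) * q := Nat.mul_le_mul_right _ (by omega)
      rw [Finset.sum_eq_zero_iff] at h
      have h₁ := h (m - 1) (by rw [Finset.mem_range]; omega)
      rw [Finset.sum_eq_zero_iff] at h₁
      have h₂ := h₁ (q - 1) (by rw [Finset.mem_range]; omega)
      rw [show 2 * (m - 1) + 3 = 2 * m + 1 by omega, show q - 1 + 1 = q by omega] at h₂
      simp at h₂

open Classical in
/-- The characteristic function of the powers of two. -/
noncomputable def isPowerOfTwo (n : ℕ) : Bool := decide (∃ k, n = 2 ^ k)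

theorem isPowerOfTwo_eq_true (n : ℕ) : isPowerOfTwo n = true ↔ ∃ k, n = 2 ^ k := by
  classical simp [isPowerOfTwo]

namespace Computes

variable {α : Type} [StringRep α]

theorem isPowerOfTwo : Computes isPowerOfTwo := by
  have h : Computes fun n : ℕ => (!decide (n = 0)) && decide (∑ a ∈ Finset.range n,
      ∑ b ∈ Finset.range n, (bif decide ((2 * a + 3) * (b + 1) = n) then 1 else 0) = 0) := by
    fun_prop
  convert h using 1
  funext n
  rw [Bool.eq_iff_iff, isPowerOfTwo_eq_true, isPowerOfTwo_iff]
  simp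

/-- The logarithm grows by one at each power of two except 1, which `j ≠ 0` excludes. -/
theorem _root_.log_eq_sum (n : ℕ) : Nat.log 2 n =
    ∑ j ∈ Finset.range n, bif _root_.isPowerOfTwo (j + 1) && decide (j ≠ 0) then 1 else 0 := by
  induction n with
  | zero => simp
  | succ n ih =>
    rw [Finset.sum_range_succ, ← ih]
    rcases Nat.eq_zero_or_pos n with rfl | hn
    · simp
    by_cases h : ∃ k, n + 1 = 2 ^ k
    · obtain ⟨k, hk⟩ := h
      have hk0 : k ≠ 0 := by rintro rfl; simp at hk; omega
      have : _root_.isPowerOfTwo (n + 1) = true := by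
        simp only [_root_.isPowerOfTwo, decide_eq_true_iff]; exact ⟨k, hk⟩
      rw [this, hk, Nat.log_pow (by norm_num)]
      have : Nat.log 2 n = k - 1 := by
        rw [Nat.log_eq_iff (by omega)]
        have : 2 ^ k = 2 * 2 ^ (k - 1) := by
          rw [← pow_succ']; congr 1; omega
        have : 2 ^ (k - 1) ≥ 1 := Nat.one_le_two_pow
        rw [show k - 1 + 1 = k by omega]
        omega
      rw [this]
      simp only [decide_not, Bool.true_and]
      rw [show decide (n = 0) = false by simp; omega]
      simp
      omega
    · have : _root_.isPowerOfTwo (n + 1) = false := by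
        simp only [_root_.isPowerOfTwo, decide_eq_false_iff_not]; exact h
      rw [this]
      simp only [Bool.false_and, cond_false, add_zero]
      rw [Nat.log_eq_iff (by omega)]
      have h₁ := Nat.pow_log_le_self 2 (show n ≠ 0 by omega)
      have h₂ := Nat.lt_pow_succ_log_self (b := 2) (by norm_num) n
      refine ⟨by omega, ?_⟩
      have : n + 1 ≠ 2 ^ (Nat.log 2 n + 1) := fun e => h ⟨_, e⟩
      rw [Nat.succ_eq_add_one] at h₂
      omega

theorem log : Computes (Nat.log 2) := by
  have h : Computes fun n : ℕ =>
      ∑ j ∈ Finset.range n, bif _root_.isPowerOfTwo (j + 1) && !decide (j = 0) then 1 else 0 := by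
    have := isPowerOfTwo
    fun_prop
  convert h using 1
  funext n
  rw [log_eq_sum]
  simp

/-- A power of two with a polynomial bound can be computed. -/
theorem two_pow {f g : α → ℕ} (hf : Computes f) (hg : Computes g) (h : ∀ a, 2 ^ f a ≤ g a) :
    Computes fun a => 2 ^ f a := by
  -- Unrestricted powers are too long in unary. Under the given bound the power is found by search,
  -- as the only nonzero term of a sum.
  have h' : Computes fun a => ∑ j ∈ Finset.range (g a + 1),
      bif _root_.isPowerOfTwo j && decide (Nat.log 2 j = f a) then j else 0 := by
    have := isPowerOfTwo
    have := log
    fun_prop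
  convert h' using 2 with a
  rw [Finset.sum_eq_single (2 ^ f a)]
  · have : _root_.isPowerOfTwo (2 ^ f a) = true := by
      simp only [_root_.isPowerOfTwo, decide_eq_true_iff]; exact ⟨_, rfl⟩
    simp [this, Nat.log_pow]
  · intro j _ hj
    by_cases hp : ∃ k, j = 2 ^ k
    · obtain ⟨k, rfl⟩ := hp
      rw [Nat.log_pow (by norm_num)]
      have : k ≠ f a := fun e => hj (by rw [e])
      simp [this]
    · have : _root_.isPowerOfTwo j = false := by
        simp only [_root_.isPowerOfTwo, decide_eq_false_iff_not]; exact hp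
      simp [this]
  · intro hj
    have := h a
    simp at hj
    omega

end Computes

/-! ### Blocks of quantifiers -/

/-- The assignment `σ` with the values of the `m` variables from `i` on replaced by `b`. -/
def overwrite (σ : ℕ → Bool) (i m : ℕ) (b : ℕ → Bool) (v : ℕ) : Bool :=
  if i ≤ v ∧ v < i + m then b (v - i) else σ v

theorem overwrite_of_lt {σ : ℕ → Bool} {i m : ℕ} {b : ℕ → Bool} {v : ℕ} (h : v < i) :
    overwrite σ i m b v = σ v := if_neg (by omega)

theorem overwrite_add {σ : ℕ → Bool} {i m : ℕ} {b : ℕ → Bool} {j : ℕ} (h : j < m) :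
    overwrite σ i m b (i + j) = b j := by
  rw [overwrite, if_pos (by omega), Nat.add_sub_cancel_left]

theorem overwrite_zero (σ : ℕ → Bool) (i : ℕ) (b : ℕ → Bool) : overwrite σ i 0 b = σ :=
  funext fun _ => if_neg (by omega)

theorem overwrite_update (σ : ℕ → Bool) (i m : ℕ) (b : ℕ → Bool) :
    overwrite (Function.update σ i (b 0)) (i + 1) m (fun j => b (j + 1)) =
      overwrite σ i (m + 1) b := by
  funext v
  rcases lt_trichotomy v i with h | rfl | h
  · rw [overwrite_of_lt (by omega), overwrite_of_lt h, Function.update_of_ne (by omega)]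
  · rw [overwrite_of_lt (by omega), overwrite, if_pos (by omega), Function.update_self,
      Nat.sub_self]
  · rw [overwrite, overwrite, Function.update_of_ne (by omega)]
    have : v - (i + 1) + 1 = v - i := by omega
    rw [this]
    exact if_congr (by omega) rfl rfl

theorem quantifiedTrue_ex_block (ψ : CNF) (qs : List Quantifier) (m i : ℕ) (σ : ℕ → Bool) :
    QuantifiedTrue ψ (List.replicate m Quantifier.ex ++ qs) i σ ↔
      ∃ b, QuantifiedTrue ψ qs (i + m) (overwrite σ i m b) := by
  induction m generalizing i σ with
  | zero => simp [overwrite_zero]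
  | succ m ih =>
    simp only [List.replicate_succ, List.cons_append, QuantifiedTrue, ih]
    constructor
    · rintro ⟨x, b, h⟩
      refine ⟨fun j => Nat.casesOn j x b, ?_⟩
      rw [← overwrite_update, ← add_assoc, add_right_comm]
      exact h
    · rintro ⟨b, h⟩
      refine ⟨b 0, fun j => b (j + 1), ?_⟩
      rwa [overwrite_update, add_right_comm, add_assoc]

theorem quantifiedTrue_all_block (ψ : CNF) (qs : List Quantifier) (m i : ℕ) (σ : ℕ → Bool) :
    QuantifiedTrue ψ (List.replicate m Quantifier.all ++ qs) i σ ↔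
      ∀ b, QuantifiedTrue ψ qs (i + m) (overwrite σ i m b) := by
  induction m generalizing i σ with
  | zero => simp [overwrite_zero]
  | succ m ih =>
    simp only [List.replicate_succ, List.cons_append, QuantifiedTrue, ih]
    constructor
    · intro h b
      rw [← overwrite_update, ← add_assoc, add_right_comm]
      exact h (b 0) fun j => b (j + 1)
    · intro h x b
      have := h fun j => Nat.casesOn j x b
      rwa [← overwrite_update, ← add_assoc, add_right_comm] at this

namespace CNF

variable {σ : ℕ → Bool} {ψ ψ' : CNF}

theorem holds_append : CNF.Holds σ (ψ ++ ψ') ↔ CNF.Holds σ ψ ∧ CNF.Holds σ ψ' :=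
  List.forall_mem_append

theorem holds_flatMap_range {m : ℕ} {f : ℕ → CNF} :
    CNF.Holds σ ((List.range m).flatMap f) ↔ ∀ j < m, CNF.Holds σ (f j) := by
  simp only [CNF.Holds, List.mem_flatMap, List.mem_range]
  exact ⟨fun h j hj C hC => h C ⟨j, hj, hC⟩, fun h C ⟨j, hj, hC⟩ => h j hj C hC⟩

theorem holds_singleton {C : Clause} : CNF.Holds σ [C] ↔ ∃ l ∈ C, l.Holds σ := by
  simp [CNF.Holds]

theorem holds_nil : CNF.Holds σ [] := by simp [CNF.Holds]

/-- The formula is a `d`-CNF on the variables `0, …, N - 1`. -/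
def Bounded (d N : ℕ) (ψ : CNF) : Prop := ψ.ArityLE d ∧ ψ.VarsLT N

theorem Bounded.append {d N : ℕ} (h : Bounded d N ψ) (h' : Bounded d N ψ') :
    Bounded d N (ψ ++ ψ') :=
  ⟨List.forall_mem_append.2 ⟨h.1, h'.1⟩, List.forall_mem_append.2 ⟨h.2, h'.2⟩⟩

theorem Bounded.flatMap_range {d N m : ℕ} {f : ℕ → CNF} (h : ∀ j < m, Bounded d N (f j)) :
    Bounded d N ((List.range m).flatMap f) := by
  constructor <;> intro C hC <;> obtain ⟨j, hj, hC⟩ := List.mem_flatMap.1 hC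
  · exact (h j (List.mem_range.1 hj)).1 C hC
  · exact (h j (List.mem_range.1 hj)).2 C hC

theorem Bounded.singleton {d N : ℕ} {C : Clause} (h : C.length ≤ d) (h' : ∀ l ∈ C, l.var < N) :
    Bounded d N [C] := by
  constructor <;> intro C hC <;> rw [List.mem_singleton.1 hC]
  exacts [h, h']

theorem Bounded.nil {d N : ℕ} : Bounded d N [] := by
  constructor <;> intro C hC <;> simp at hC

end CNF

/-! ### The quantified formula of a 3-CNF -/

namespace Refutation

/-- The number of strings of `2 ^ h` bits. -/
def tower (h : ℕ) : ℕ := 2 ^ 2 ^ h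

section layout

variable (n H : ℕ)

/-- The first variable of the block of depth `d`. -/
def blockStart (d : ℕ) : ℕ :=
  n + 1 + ∑ k ∈ Finset.range d, (3 * 2 ^ (H - k) + 3 * tower (H - k))

/-- The bit `t` of the string `i` in the block of depth `d`. -/
def bitVar (d i t : ℕ) : ℕ := blockStart n H d + (i * 2 ^ (H - d) + t)

/-- The claim that the string `i` in the block of depth `d` is the binary expansion of `c`. -/
def claimVar (d i c : ℕ) : ℕ := blockStart n H d + 3 * 2 ^ (H - d) + (i * tower (H - d) + c)

/-- The number of the first gate for the block of depth `d`. -/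
def gateStart (d : ℕ) : ℕ := 1 + ∑ k ∈ Finset.range d, 3 * 2 ^ (H - k)

/-- The number of the gate for the bit `t` of the string `i` in the block of depth `d`. -/
def gate (d i t : ℕ) : ℕ := gateStart H d + (i * 2 ^ (H - d) + t)

/-- The number of gates. -/
def numGates : ℕ := gateStart H (H + 1)

/-- The variable of the gate with number `c`. -/
def gateVar (c : ℕ) : ℕ := blockStart n H (H + 1) + c

/-- The variables of the chain that forces one of the gates to be open. -/
def chainVar (c : ℕ) : ℕ := blockStart n H (H + 1) + numGates H + c

/-- The quantifiers of the block of depth `d`. -/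
def blockQuants (d : ℕ) : List Quantifier :=
  List.replicate (3 * 2 ^ (H - d)) Quantifier.ex ++
    List.replicate (3 * tower (H - d)) Quantifier.all

/-- The quantifier prefix. -/
def quants : List Quantifier :=
  -- Variable `n` occurs in no clause; it supplies a false literal to pad clauses with fewer than
  -- three literals.
  List.replicate (n + 1) Quantifier.all ++ ((List.range (H + 1)).flatMap (blockQuants H) ++
    List.replicate (2 * numGates H + 1) Quantifier.ex)

/-- Some gate is open. -/
def chainClauses : CNF :=
  [[⟨chainVar n H 0, true⟩]] ++ ((List.range (numGates H)).flatMap (fun c =>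
    [[⟨chainVar n H c, false⟩, ⟨chainVar n H (c + 1), true⟩, ⟨gateVar n H c, true⟩]]) ++
    [[⟨chainVar n H (numGates H), false⟩]])

/-- If the first gate is open, the claims in the block of depth `0` are about the codes of three
false literals that cover a clause. -/
def topClauses (ψ : CNF) : CNF :=
  (List.range 3).flatMap (fun i => (List.range (n + 1)).flatMap fun v =>
    [[⟨gateVar n H 0, false⟩, ⟨v, false⟩, ⟨claimVar n H 0 i (2 * v), false⟩]] ++
    [[⟨gateVar n H 0, false⟩, ⟨v, true⟩, ⟨claimVar n H 0 i (2 * v + 1), false⟩]]) ++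
  (List.range (tower H)).flatMap fun a => (List.range (tower H)).flatMap fun b =>
    (List.range (tower H)).flatMap fun c => bif ψ.covers a b c then [] else
      [[⟨gateVar n H 0, false⟩, ⟨claimVar n H 0 0 a, false⟩, ⟨claimVar n H 0 1 b, false⟩,
        ⟨claimVar n H 0 2 c, false⟩]]

/-- If the gate for a bit of the block of depth `d` is open, this bit differs from the
corresponding one in the next block, but the claims in the next block imply one about it. -/
def stepClauses (d : ℕ) : CNF :=
  (List.range 3).flatMap fun i => (List.range (2 ^ (H - d))).flatMap fun t =>
    [[⟨gateVar n H (gate H d i t), false⟩, ⟨bitVar n H d i t, true⟩,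
      ⟨bitVar n H (d + 1) 0 t, true⟩]] ++
    ([[⟨gateVar n H (gate H d i t), false⟩, ⟨bitVar n H d i t, false⟩,
      ⟨bitVar n H (d + 1) 0 t, false⟩]] ++
    (List.range (tower (H - (d + 1)))).flatMap fun a =>
      (List.range (tower (H - (d + 1)))).flatMap fun b =>
        [[⟨gateVar n H (gate H d i t), false⟩,
          ⟨claimVar n H d i (tower (H - (d + 1)) * b + a), true⟩,
          ⟨claimVar n H (d + 1) 0 a, false⟩, ⟨claimVar n H (d + 1) 1 b, false⟩]])

/-- If the gate for a string of the last block is open, some claim about it is wrong. -/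
def baseClauses : CNF :=
  (List.range 3).flatMap fun i =>
    [[⟨gateVar n H (gate H H i 0), false⟩, ⟨bitVar n H H i 0, true⟩, ⟨claimVar n H H i 1, true⟩]] ++
    [[⟨gateVar n H (gate H H i 0), false⟩, ⟨bitVar n H H i 0, false⟩, ⟨claimVar n H H i 0, true⟩]]

/-- The matrix. -/
def matrix (ψ : CNF) : CNF :=
  chainClauses n H ++ (topClauses n H ψ ++
    ((List.range H).flatMap (stepClauses n H) ++ baseClauses n H))

end layout

/-! #### Positions of the variables -/

section positions

variable {n H : ℕ}

theorem blockStart_succ (d : ℕ) : blockStart n H (d + 1) =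
    blockStart n H d + 3 * 2 ^ (H - d) + 3 * tower (H - d) := by
  rw [blockStart, Finset.sum_range_succ, blockStart]
  omega

theorem blockStart_mono {d d' : ℕ} (h : d ≤ d') : blockStart n H d ≤ blockStart n H d' :=
  monotone_nat_of_le_succ (fun d => by rw [blockStart_succ]; omega) h

theorem mul_add_lt {i t m : ℕ} (hi : i < 3) (ht : t < m) : i * m + t < 3 * m := by
  have : (i + 1) * m ≤ 3 * m := Nat.mul_le_mul_right _ hi
  rw [add_mul] at this
  omega

theorem mul_add_inj {i t i' t' m : ℕ} (ht : t < m) (ht' : t' < m)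
    (h : i * m + t = i' * m + t') : i = i' ∧ t = t' := by
  have h₁ := congrArg (· / m) h
  have h₂ := congrArg (· % m) h
  have hm : 0 < m := by omega
  simp only [mul_comm _ m, Nat.mul_add_div hm, Nat.div_eq_of_lt ht, Nat.div_eq_of_lt ht',
    Nat.mul_add_mod, Nat.mod_eq_of_lt ht, Nat.mod_eq_of_lt ht'] at h₁ h₂
  exact ⟨h₁, h₂⟩

theorem bitVar_lt {d i t : ℕ} (hi : i < 3) (ht : t < 2 ^ (H - d)) :
    bitVar n H d i t < blockStart n H d + 3 * 2 ^ (H - d) := by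
  have := mul_add_lt hi ht
  rw [bitVar]
  omega

theorem bitVar_lt' {d d' i t : ℕ} (hd : d < d') (hi : i < 3) (ht : t < 2 ^ (H - d)) :
    bitVar n H d i t < blockStart n H d' := by
  have := bitVar_lt (n := n) hi ht
  have := blockStart_mono (n := n) (H := H) (Nat.succ_le_of_lt hd)
  rw [blockStart_succ] at this
  omega

/-- Strings `0` and `1` of a block are adjacent, so an index running past the end of string `0`
continues in string `1`. One index thus addresses the concatenation of two halves. -/
theorem bitVar_zero_add (d t : ℕ) : bitVar n H d 0 (2 ^ (H - d) + t) = bitVar n H d 1 t := by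
  rw [bitVar, bitVar, zero_mul, one_mul, zero_add]

theorem two_pow_sub {d : ℕ} (hd : d < H) : 2 ^ (H - d) = 2 ^ (H - (d + 1)) + 2 ^ (H - (d + 1)) := by
  rw [← two_mul, ← pow_succ']
  congr 1
  omega

theorem bitVar_zero_lt {d t : ℕ} (hd : d < H) (ht : t < 2 ^ (H - d)) :
    bitVar n H (d + 1) 0 t < blockStart n H (d + 2) := by
  rcases lt_or_ge t (2 ^ (H - (d + 1))) with h | h
  · exact bitVar_lt' (by omega) (by omega) h
  · obtain ⟨t, rfl⟩ := Nat.exists_eq_add_of_le h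
    rw [bitVar_zero_add]
    rw [two_pow_sub hd] at ht
    exact bitVar_lt' (by omega) (by omega) (by omega)

theorem claim_lt_tower {d a b : ℕ} (hd : d < H) (ha : a < tower (H - (d + 1)))
    (hb : b < tower (H - (d + 1))) : tower (H - (d + 1)) * b + a < tower (H - d) := by
  have : tower (H - d) = tower (H - (d + 1)) * tower (H - (d + 1)) := by
    rw [tower, two_pow_sub hd, pow_add, tower]
  rw [this]
  have : tower (H - (d + 1)) * (b + 1) ≤ tower (H - (d + 1)) * tower (H - (d + 1)) :=
    Nat.mul_le_mul_left _ hb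
  rw [mul_add] at this
  omega

theorem claimVar_lt {d d' i c : ℕ} (hd : d < d') (hi : i < 3) (hc : c < tower (H - d)) :
    claimVar n H d i c < blockStart n H d' := by
  have := mul_add_lt hi hc
  have := blockStart_mono (n := n) (H := H) (Nat.succ_le_of_lt hd)
  rw [blockStart_succ] at this
  rw [claimVar]
  omega

theorem lt_blockStart {v : ℕ} (d : ℕ) (h : v ≤ n) : v < blockStart n H d := by
  rw [blockStart]
  omega

theorem gateStart_succ (d : ℕ) : gateStart H (d + 1) = gateStart H d + 3 * 2 ^ (H - d) := by
  rw [gateStart, Finset.sum_range_succ, gateStart]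
  omega

theorem gateStart_mono {d d' : ℕ} (h : d ≤ d') : gateStart H d ≤ gateStart H d' :=
  monotone_nat_of_le_succ (fun d => by rw [gateStart_succ]; omega) h

theorem gate_pos (d i t : ℕ) : 0 < gate H d i t := by
  rw [gate, gateStart]
  omega

theorem gate_lt_gateStart {d i t d' : ℕ} (hd : d < d') (hi : i < 3) (ht : t < 2 ^ (H - d)) :
    gate H d i t < gateStart H d' := by
  have := mul_add_lt hi ht
  have := gateStart_mono (H := H) (Nat.succ_le_of_lt hd)
  rw [gateStart_succ] at this
  rw [gate]
  omega

theorem gate_lt {d i t : ℕ} (hd : d ≤ H) (hi : i < 3) (ht : t < 2 ^ (H - d)) :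
    gate H d i t < numGates H :=
  gate_lt_gateStart (by omega) hi ht

theorem gateStart_le_gate (d i t : ℕ) : gateStart H d ≤ gate H d i t := Nat.le_add_right _ _

theorem gate_inj {d i t d' i' t' : ℕ} (hi : i < 3) (ht : t < 2 ^ (H - d)) (hi' : i' < 3)
    (ht' : t' < 2 ^ (H - d')) (h : gate H d i t = gate H d' i' t') : d = d' ∧ i = i' ∧ t = t' := by
  rcases lt_trichotomy d d' with hd | rfl | hd
  · have := gate_lt_gateStart hd hi ht
    have := gateStart_le_gate (H := H) d' i' t'
    omega
  · exact ⟨rfl, mul_add_inj ht ht' (Nat.add_left_cancel h)⟩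
  · have := gate_lt_gateStart hd hi' ht'
    have := gateStart_le_gate (H := H) d i t
    omega

/-- Counterpart of `gate_inj`: an open gate other than the first determines a block, a string and a
bit. -/
theorem exists_gate {c d : ℕ} (hc : c ≠ 0) (h : c < gateStart H d) :
    ∃ d' < d, ∃ i < 3, ∃ t < 2 ^ (H - d'), c = gate H d' i t := by
  induction d with
  | zero => simp [gateStart] at h; omega
  | succ d ih =>
    by_cases h' : c < gateStart H d
    · obtain ⟨d', hd', h⟩ := ih h'
      exact ⟨d', by omega, h⟩
    · rw [gateStart_succ] at h
      have hpos : 0 < 2 ^ (H - d) := by positivity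
      refine ⟨d, by omega, (c - gateStart H d) / 2 ^ (H - d), ?_, (c - gateStart H d) % 2 ^ (H - d),
        Nat.mod_lt _ hpos, ?_⟩
      · rw [Nat.div_lt_iff_lt_mul hpos]; omega
      · rw [gate, mul_comm, Nat.div_add_mod]; omega

theorem length_quants : (quants n H).length = blockStart n H (H + 1) + (2 * numGates H + 1) := by
  have : ∀ d, ((List.range d).flatMap (blockQuants H)).length + (n + 1) = blockStart n H d := by
    intro d
    induction d with
    | zero => simp [blockStart]
    | succ d ih =>
      rw [blockStart_succ, ← ih, List.range_succ, List.flatMap_append]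
      simp [blockQuants]
      omega
  rw [quants, ← this]
  simp
  omega

/-- The bits of the strings are as many as the gates without the first one; to these come the gates
themselves and a chain with one variable more. -/
theorem count_quants : (quants n H).count Quantifier.ex = 3 * numGates H := by
  have : ∀ d, ((List.range d).flatMap (blockQuants H)).count Quantifier.ex + 1 =
      gateStart H d := by
    intro d
    induction d with
    | zero => simp [gateStart]
    | succ d ih =>
      rw [gateStart_succ, ← ih, List.range_succ, List.flatMap_append]
      simp [blockQuants, List.count_replicate]
      omega
  have := this (H + 1)
  rw [quants, List.count_append, List.count_append]
  simp only [List.count_replicate]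
  rw [numGates]
  simp
  omega

/-- The hypothesis on `tower H` ensures that the codes of all literals occur among the values
claimed in block `0`. -/
theorem bounded_matrix (ψ : CNF) (hH : 2 * n + 2 ≤ tower H) :
    (matrix n H ψ).Bounded 4 (quants n H).length := by
  have hg : ∀ {c}, c < numGates H → gateVar n H c < (quants n H).length := by
    intro c hc; rw [length_quants, gateVar]; omega
  have hu : ∀ {c}, c ≤ numGates H → chainVar n H c < (quants n H).length := by
    intro c hc; rw [length_quants, chainVar]; omega
  have hx : ∀ {v}, v < blockStart n H (H + 1) → v < (quants n H).length := by
    intro v hv; rw [length_quants]; omega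
  have h0 : 0 < numGates H := by rw [numGates, gateStart]; omega
  refine .append (.append (.singleton (by simp) ?_) (.append (.flatMap_range fun c hc =>
    .singleton (by simp) ?_) (.singleton (by simp) ?_))) (.append (.append (.flatMap_range
    fun i hi => .flatMap_range fun v hv => .append (.singleton (by simp) ?_)
    (.singleton (by simp) ?_)) (.flatMap_range fun a ha => .flatMap_range fun b hb =>
    .flatMap_range fun c hc => ?_)) (.append (.flatMap_range fun d hd => .flatMap_range fun i hi =>
    .flatMap_range fun t ht => .append (.singleton (by simp) ?_) (.append (.singleton (by simp) ?_)
    (.flatMap_range fun a ha => .flatMap_range fun b hb => .singleton (by simp) ?_)))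
    (.flatMap_range fun i hi => .append (.singleton (by simp) ?_) (.singleton (by simp) ?_))))
  · simpa using hu (by omega)
  · simpa using ⟨hu (by omega), hu (by omega), hg hc⟩
  · simpa using hu (by omega)
  · simpa using ⟨hg h0, hx (lt_blockStart _ (by omega)),
      hx (claimVar_lt (by omega) hi (by simp; omega))⟩
  · simpa using ⟨hg h0, hx (lt_blockStart _ (by omega)),
      hx (claimVar_lt (by omega) hi (by simp; omega))⟩
  · cases ψ.covers a b c
    · refine .singleton (by simp) ?_
      simpa using ⟨hg h0, hx (claimVar_lt (by omega) (by omega) (by simpa using ha)),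
        hx (claimVar_lt (by omega) (by omega) (by simpa using hb)),
        hx (claimVar_lt (by omega) (by omega) (by simpa using hc))⟩
    · exact .nil
  · simpa using ⟨hg (gate_lt (by omega) hi ht), hx (bitVar_lt' (by omega) hi ht),
      hx ((bitVar_zero_lt hd ht).trans_le (blockStart_mono (by omega)))⟩
  · simpa using ⟨hg (gate_lt (by omega) hi ht), hx (bitVar_lt' (by omega) hi ht),
      hx ((bitVar_zero_lt hd ht).trans_le (blockStart_mono (by omega)))⟩
  · simpa using ⟨hg (gate_lt (by omega) hi ht),
      hx (claimVar_lt (by omega) hi (claim_lt_tower hd ha hb)),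
      hx (claimVar_lt (by omega) (by omega) ha), hx (claimVar_lt (by omega) (by omega) hb)⟩
  · simpa using ⟨hg (gate_lt le_rfl hi (by simp)), hx (bitVar_lt' (by omega) hi (by simp)),
      hx (claimVar_lt (by omega) hi (by simp [tower]))⟩
  · simpa using ⟨hg (gate_lt le_rfl hi (by simp)), hx (bitVar_lt' (by omega) hi (by simp)),
      hx (claimVar_lt (by omega) hi (by simp [tower]))⟩

end positions

/-! #### The meaning of the matrix -/

section semantics

variable {n H : ℕ} {ψ : CNF} {σ τ : ℕ → Bool}

variable (n H ψ σ) in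
/-- What the first gate requires. -/
def TopSound : Prop :=
  (∀ i < 3, ∀ v < n + 1, (σ (claimVar n H 0 i (2 * v)) = true → σ v = false) ∧
    (σ (claimVar n H 0 i (2 * v + 1)) = true → σ v = true)) ∧
  ∀ a < tower H, ∀ b < tower H, ∀ c < tower H, σ (claimVar n H 0 0 a) = true →
    σ (claimVar n H 0 1 b) = true → σ (claimVar n H 0 2 c) = true → ψ.covers a b c = true

variable (n H σ) in
/-- What the gate for a bit requires. -/
def StepSound (d i t : ℕ) : Prop :=
  σ (bitVar n H d i t) ≠ σ (bitVar n H (d + 1) 0 t) ∧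
  ∀ a < tower (H - (d + 1)), ∀ b < tower (H - (d + 1)), σ (claimVar n H (d + 1) 0 a) = true →
    σ (claimVar n H (d + 1) 1 b) = true →
    σ (claimVar n H d i (tower (H - (d + 1)) * b + a)) = true

variable (n H σ) in
/-- What the gate for a string of the last block requires. -/
def BaseSound (i : ℕ) : Prop :=
  (σ (bitVar n H H i 0) = false → σ (claimVar n H H i 1) = true) ∧
  (σ (bitVar n H H i 0) = true → σ (claimVar n H H i 0) = true)

theorem holds_matrix : CNF.Holds σ (matrix n H ψ) ↔
    (σ (chainVar n H 0) = true ∧ (∀ c < numGates H, σ (chainVar n H c) = true →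
      σ (chainVar n H (c + 1)) = true ∨ σ (gateVar n H c) = true) ∧
      σ (chainVar n H (numGates H)) = false) ∧
    (σ (gateVar n H 0) = true → TopSound n H ψ σ) ∧
    (∀ d < H, ∀ i < 3, ∀ t < 2 ^ (H - d), σ (gateVar n H (gate H d i t)) = true →
      StepSound n H σ d i t) ∧
    ∀ i < 3, σ (gateVar n H (gate H H i 0)) = true → BaseSound n H σ i := by
  have hb : ∀ {b c : Bool}, (b = false ∨ c = true) ↔ (b = true → c = true) := by decide
  have hbif : ∀ (b : Bool) (C : Clause), CNF.Holds σ (bif b then [] else [C]) ↔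
      (b = false → ∃ l ∈ C, l.Holds σ) := by
    intro b C
    cases b
    · simp [CNF.holds_singleton]
    · simp [CNF.holds_nil]
  simp only [matrix, chainClauses, topClauses, stepClauses, baseClauses, CNF.holds_append,
    CNF.holds_flatMap_range, CNF.holds_singleton, hbif, List.mem_cons, List.not_mem_nil, or_false,
    exists_eq_or_imp, exists_eq_left, Literal.Holds]
  refine and_congr ?_ (and_congr ?_ (and_congr ?_ ?_))
  · refine and_congr_right fun _ => and_congr_left fun _ => forall₂_congr fun c _ => ?_
    cases σ (chainVar n H c) <;> simp
  · cases σ (gateVar n H 0)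
    · simp
    · simp only [TopSound, reduceCtorEq, false_or, true_imp_iff]
      refine and_congr (forall₄_congr fun i _ v _ => ?_)
        (forall₄_congr fun a _ b _ => forall₂_congr fun c _ => ?_)
      · cases σ v <;> simp
      · cases σ (claimVar n H 0 0 a) <;> cases σ (claimVar n H 0 1 b) <;>
          cases σ (claimVar n H 0 2 c) <;> cases ψ.covers a b c <;> simp
  · refine forall₄_congr fun d _ i _ => forall₂_congr fun t _ => ?_
    cases σ (gateVar n H (gate H d i t))
    · simp
    · simp only [StepSound, reduceCtorEq, false_or, true_imp_iff, ← and_assoc]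
      refine and_congr ?_ (forall₄_congr fun a _ b _ => ?_)
      · cases σ (bitVar n H d i t) <;> cases σ (bitVar n H (d + 1) 0 t) <;> simp
      · cases σ (claimVar n H (d + 1) 0 a) <;> cases σ (claimVar n H (d + 1) 1 b) <;> simp
  · refine forall₂_congr fun i _ => ?_
    cases σ (gateVar n H (gate H H i 0))
    · simp
    · cases h : σ (bitVar n H H i 0) <;> simp [BaseSound, h]

variable (n H ψ) in
/-- The requirements of some gate for the variables before the block of depth `d` are met. -/
def SomeSound (d : ℕ) (σ : ℕ → Bool) : Prop :=
  (0 < d ∧ TopSound n H ψ σ) ∨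
  (∃ d', d' + 1 < d ∧ d' < H ∧ ∃ i < 3, ∃ t < 2 ^ (H - d'), StepSound n H σ d' i t) ∨
  (H < d ∧ ∃ i < 3, BaseSound n H σ i)

theorem TopSound.congr (hH : 2 * n + 2 ≤ tower H) (h : TopSound n H ψ σ)
    (hστ : ∀ v < blockStart n H 1, τ v = σ v) : TopSound n H ψ τ := by
  have hc : ∀ i < 3, ∀ c < tower H, τ (claimVar n H 0 i c) = σ (claimVar n H 0 i c) :=
    fun i hi c hc => hστ _ (claimVar_lt (by omega) hi hc)
  refine ⟨fun i hi v hv => ?_, fun a ha b hb c hc' => ?_⟩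
  · rw [hc i hi _ (by omega), hc i hi _ (by omega), hστ v (lt_blockStart _ (by omega))]
    exact h.1 i hi v hv
  · rw [hc 0 (by omega) a ha, hc 1 (by omega) b hb, hc 2 (by omega) c hc']
    exact h.2 a ha b hb c hc'

theorem StepSound.congr {d i t : ℕ} (hd : d < H) (hi : i < 3) (ht : t < 2 ^ (H - d))
    (h : StepSound n H σ d i t) (hστ : ∀ v < blockStart n H (d + 2), τ v = σ v) :
    StepSound n H τ d i t := by
  refine ⟨?_, fun a ha b hb => ?_⟩
  · rw [hστ _ (bitVar_lt' (by omega) hi ht), hστ _ (bitVar_zero_lt hd ht)]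
    exact h.1
  · rw [hστ _ (claimVar_lt (by omega) (by omega) ha), hστ _ (claimVar_lt (by omega) (by omega) hb),
      hστ _ (claimVar_lt (by omega) hi (claim_lt_tower hd ha hb))]
    exact h.2 a ha b hb

theorem BaseSound.congr {i : ℕ} (hi : i < 3) (h : BaseSound n H σ i)
    (hστ : ∀ v < blockStart n H (H + 1), τ v = σ v) : BaseSound n H τ i := by
  rw [BaseSound, hστ _ (bitVar_lt' (by omega) hi (by simp)),
    hστ _ (claimVar_lt (by omega) hi (by simp [tower])),
    hστ _ (claimVar_lt (by omega) hi (by simp [tower]))]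
  exact h

/-- Only variables before the block of depth `d` matter, so an accusation that succeeds cannot be
spoiled by later moves. -/
theorem SomeSound.congr {d : ℕ} (hH : 2 * n + 2 ≤ tower H) (h : SomeSound n H ψ d σ)
    (hστ : ∀ v < blockStart n H d, τ v = σ v) : SomeSound n H ψ d τ := by
  have hmono : ∀ {d'}, d' ≤ d → ∀ v < blockStart n H d', τ v = σ v :=
    fun h v hv => hστ v (hv.trans_le (blockStart_mono h))
  rcases h with ⟨hd, h⟩ | ⟨d', hd, hd', i, hi, t, ht, h⟩ | ⟨hd, i, hi, h⟩
  · exact .inl ⟨hd, h.congr hH (hmono hd)⟩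
  · exact .inr (.inl ⟨d', hd, hd', i, hi, t, ht, h.congr hd' hi ht (hmono hd)⟩)
  · exact .inr (.inr ⟨hd, i, hi, h.congr hi (hmono hd)⟩)

theorem SomeSound.mono {d d' : ℕ} (hd : d ≤ d') (h : SomeSound n H ψ d σ) :
    SomeSound n H ψ d' σ := by
  rcases h with ⟨h, h'⟩ | ⟨k, h, h'⟩ | ⟨h, h'⟩
  · exact .inl ⟨by omega, h'⟩
  · exact .inr (.inl ⟨k, by omega, h'⟩)
  · exact .inr (.inr ⟨by omega, h'⟩)

/-- The chain starts true, ends false and can fall only at an open gate, so some gate is open.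
Conversely a single open gate suffices, since closed gates require nothing. -/
theorem quantifiedTrue_gates (hH : 2 * n + 2 ≤ tower H) :
    QuantifiedTrue (matrix n H ψ) (List.replicate (2 * numGates H + 1) Quantifier.ex)
      (blockStart n H (H + 1)) σ ↔ SomeSound n H ψ (H + 1) σ := by
  have hG : 0 < numGates H := by rw [numGates, gateStart]; omega
  rw [← List.append_nil (List.replicate _ _), quantifiedTrue_ex_block]
  simp only [QuantifiedTrue]
  constructor
  · rintro ⟨b, hb⟩
    refine SomeSound.congr hH (σ := overwrite σ (blockStart n H (H + 1)) (2 * numGates H + 1) b) ?_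
      fun v hv => (overwrite_of_lt hv).symm
    generalize overwrite σ _ _ b = τ at hb
    obtain ⟨⟨h0, hs, hl⟩, htop, hstep, hbase⟩ := holds_matrix.1 hb
    have : ∃ c < numGates H, τ (gateVar n H c) = true := by
      by_contra! hne
      have : ∀ c ≤ numGates H, τ (chainVar n H c) = true := by
        intro c
        induction c with
        | zero => exact fun _ => h0
        | succ c ih => exact fun hc => (hs c hc (ih (by omega))).resolve_right (hne c hc)
      rw [this _ le_rfl] at hl
      exact absurd hl (by simp)
    obtain ⟨c, hc, hc'⟩ := this
    rcases Nat.eq_zero_or_pos c with rfl | hpos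
    · exact .inl ⟨by omega, htop hc'⟩
    · obtain ⟨d, hd, i, hi, t, ht, rfl⟩ := exists_gate hpos.ne' hc
      rcases Nat.lt_succ_iff_lt_or_eq.1 hd with hd | rfl
      · exact .inr (.inl ⟨d, by omega, hd, i, hi, t, ht, hstep d hd i hi t ht hc'⟩)
      · obtain rfl : t = 0 := by simpa using ht
        exact .inr (.inr ⟨by omega, i, hi, hbase i hi hc'⟩)
  · intro h
    have key : ∀ c < numGates H, (c = 0 → TopSound n H ψ σ) →
        (∀ d < H, ∀ i < 3, ∀ t < 2 ^ (H - d), gate H d i t = c → StepSound n H σ d i t) →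
        (∀ i < 3, gate H H i 0 = c → BaseSound n H σ i) →
        ∃ b, CNF.Holds (overwrite σ (blockStart n H (H + 1)) (2 * numGates H + 1) b)
          (matrix n H ψ) := by
      intro c hc htop hstep hbase
      -- Only gate `c` is open, and the chain is true up to position `c`; the chain variables come
      -- after the gates.
      refine ⟨fun j => if j < numGates H then decide (j = c) else decide (j ≤ numGates H + c), ?_⟩
      set τ := overwrite σ (blockStart n H (H + 1)) (2 * numGates H + 1) fun j =>
        if j < numGates H then decide (j = c) else decide (j ≤ numGates H + c) with hτ
      have hστ : ∀ v < blockStart n H (H + 1), τ v = σ v := fun v hv => overwrite_of_lt hv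
      have hgate : ∀ j < numGates H, τ (gateVar n H j) = decide (j = c) := by
        intro j hj
        rw [hτ, gateVar, overwrite_add (by omega), if_pos hj]
      have hchain : ∀ j ≤ numGates H, τ (chainVar n H j) = decide (j ≤ c) := by
        intro j hj
        rw [hτ, chainVar, add_assoc, overwrite_add (by omega), if_neg (by omega)]
        simp
      refine holds_matrix.2 ⟨⟨?_, fun j hj => ?_, ?_⟩, fun h0 => ?_, fun d hd i hi t ht h0 => ?_,
        fun i hi h0 => ?_⟩
      · simp [hchain]
      · rw [hchain j hj.le, hchain (j + 1) hj, hgate j hj]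
        simp only [decide_eq_true_eq]
        omega
      · rw [hchain _ le_rfl]
        simpa using hc
      · rw [hgate 0 hG, decide_eq_true_eq] at h0
        exact (htop h0.symm).congr hH fun v hv => hστ v (hv.trans_le (blockStart_mono (by omega)))
      · rw [hgate _ (gate_lt hd.le hi ht), decide_eq_true_eq] at h0
        exact (hstep d hd i hi t ht h0).congr hd hi ht
          fun v hv => hστ v (hv.trans_le (blockStart_mono (by omega)))
      · rw [hgate _ (gate_lt le_rfl hi (by simp)), decide_eq_true_eq] at h0
        exact (hbase i hi h0).congr hi hστ
    have hz : (0 : ℕ) < 2 ^ (H - H) := by simp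
    rcases h with ⟨_, h⟩ | ⟨d, _, hd, i, hi, t, ht, h⟩ | ⟨_, i, hi, h⟩
    · exact key 0 hG (fun _ => h) (fun d _ i _ t _ h => absurd h (gate_pos d i t).ne')
        fun i _ h => absurd h (gate_pos H i 0).ne'
    · refine key (gate H d i t) (gate_lt hd.le hi ht) (fun h => absurd h (gate_pos d i t).ne') ?_ ?_
      · intro d' _ i' hi' t' ht' heq
        obtain ⟨rfl, rfl, rfl⟩ := gate_inj hi' ht' hi ht heq
        exact h
      · intro i' hi' heq
        exact absurd (gate_inj hi' hz hi ht heq).1 hd.ne'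
    · refine key (gate H H i 0) (gate_lt le_rfl hi hz) (fun h => absurd h (gate_pos H i 0).ne')
        ?_ ?_
      · intro d' hd' i' hi' t' ht' heq
        exact absurd (gate_inj hi' ht' hi hz heq).1 hd'.ne
      · intro i' hi' heq
        obtain ⟨-, rfl, -⟩ := gate_inj hi' hz hi hz heq
        exact h

end semantics

end Refutation

namespace Refutation

/-! #### The game -/

variable {n H : ℕ} {ψ : CNF} {σ τ : ℕ → Bool}

variable (n H σ) in
/-- The string `i` in the block of depth `d` is the binary expansion of `c`. -/
def Matches (d i c : ℕ) : Prop := ∀ t < 2 ^ (H - d), c.testBit t = σ (bitVar n H d i t)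

theorem Matches.congr {d i c : ℕ} (hi : i < 3) (hστ : ∀ v < blockStart n H (d + 1), τ v = σ v) :
    Matches n H τ d i c ↔ Matches n H σ d i c :=
  forall₂_congr fun t ht => by rw [hστ _ (bitVar_lt' (by omega) hi ht)]

theorem exists_testBit (m : ℕ) (f : ℕ → Bool) : ∃ c < 2 ^ m, ∀ t < m, c.testBit t = f t :=
  ⟨Nat.ofBits fun t : Fin m => f t, Nat.ofBits_lt_two_pow _,
    fun t ht => Nat.testBit_ofBits_lt _ t ht⟩

theorem eq_of_testBit {m a b : ℕ} (ha : a < 2 ^ m) (hb : b < 2 ^ m)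
    (h : ∀ t < m, a.testBit t = b.testBit t) : a = b := by
  refine Nat.eq_of_testBit_eq fun t => ?_
  rcases lt_or_ge t m with ht | ht
  · exact h t ht
  · rw [Nat.testBit_lt_two_pow (ha.trans_le (Nat.pow_le_pow_right (by omega) ht)),
      Nat.testBit_lt_two_pow (hb.trans_le (Nat.pow_le_pow_right (by omega) ht))]

/-- String `0` holds the low half of the bits and string `1` the high half. -/
theorem Matches.testBit_pair {d a b : ℕ} (hd : d < H) (ha' : a < tower (H - (d + 1)))
    (ha : Matches n H σ (d + 1) 0 a) (hb : Matches n H σ (d + 1) 1 b) {t : ℕ}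
    (ht : t < 2 ^ (H - d)) :
    (tower (H - (d + 1)) * b + a).testBit t = σ (bitVar n H (d + 1) 0 t) := by
  rw [tower, Nat.testBit_two_pow_mul_add _ ha']
  split_ifs with h
  · exact ha t h
  · obtain ⟨t, rfl⟩ := Nat.exists_eq_add_of_le (not_lt.1 h)
    rw [two_pow_sub hd] at ht
    rw [Nat.add_sub_cancel_left, bitVar_zero_add]
    exact hb t (by omega)

variable (n H σ) in
/-- The assignment after the moves `b` and `b'` in the block of depth `d`. -/
def move (d : ℕ) (b b' : ℕ → Bool) : ℕ → Bool :=
  overwrite (overwrite σ (blockStart n H d) (3 * 2 ^ (H - d)) b)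
    (blockStart n H d + 3 * 2 ^ (H - d)) (3 * tower (H - d)) b'

theorem move_of_lt {d v : ℕ} {b b' : ℕ → Bool} (h : v < blockStart n H d) :
    move n H σ d b b' v = σ v := by
  rw [move, overwrite_of_lt (by omega), overwrite_of_lt h]

theorem move_add {d j : ℕ} {b b' : ℕ → Bool} (h : j < 3 * 2 ^ (H - d)) :
    move n H σ d b b' (blockStart n H d + j) = b j := by
  rw [move, overwrite_of_lt (by omega), overwrite_add h]

theorem move_claimVar {d i c : ℕ} {b b' : ℕ → Bool} (hi : i < 3) (hc : c < tower (H - d)) :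
    move n H σ d b b' (claimVar n H d i c) = b' (i * tower (H - d) + c) :=
  overwrite_add (mul_add_lt hi hc)

theorem quantifiedTrue_block (qs : List Quantifier) (d k : ℕ) :
    QuantifiedTrue ψ ((List.range' d (k + 1)).flatMap (blockQuants H) ++ qs) (blockStart n H d) σ ↔
      ∃ b, ∀ b', QuantifiedTrue ψ ((List.range' (d + 1) k).flatMap (blockQuants H) ++ qs)
        (blockStart n H (d + 1)) (move n H σ d b b') := by
  rw [List.range'_succ, List.flatMap_cons, blockQuants, List.append_assoc, List.append_assoc,
    quantifiedTrue_ex_block]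
  simp only [quantifiedTrue_all_block, blockStart_succ, move]

variable (n H) in
/-- The claims in the blocks before depth `d` are exactly the true ones. -/
def Honest (d : ℕ) (σ : ℕ → Bool) : Prop :=
  ∀ d' < d, ∀ i < 3, ∀ c < tower (H - d'), σ (claimVar n H d' i c) = true ↔ Matches n H σ d' i c

/-- True claims defeat every accusation. At the top, the values claimed would cover a clause whose
literals are all false under `s`. At a step, the true values of the halves yield a claim about the
longer string; being true, it excludes a differing bit. At the base, the required claim is false. -/
theorem not_someSound_of_honest {s : ℕ → Bool} (hψ : ψ.Holds s) (hn : ψ.VarsLT n)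
    (hs : ∀ v ≤ n, σ v = s v) (hσ : Honest n H (H + 1) σ) :
    ¬ SomeSound n H ψ (H + 1) σ := by
  rintro (⟨_, h⟩ | ⟨d, -, hd, i, hi, t, ht, h⟩ | ⟨_, i, hi, h⟩)
  · have hex : ∀ i < 3, ∃ c < tower H, σ (claimVar n H 0 i c) = true := by
      intro i hi
      obtain ⟨c, hc, hc'⟩ := exists_testBit (2 ^ (H - 0)) fun t => σ (bitVar n H 0 i t)
      exact ⟨c, hc, (hσ 0 (by omega) i hi c hc).2 hc'⟩
    obtain ⟨a, ha, ha'⟩ := hex 0 (by omega)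
    obtain ⟨b, hb, hb'⟩ := hex 1 (by omega)
    obtain ⟨c, hc, hc'⟩ := hex 2 (by omega)
    have := h.2 a ha b hb c hc ha' hb' hc'
    rw [CNF.covers, List.any_eq_true] at this
    obtain ⟨C, hC, hall⟩ := this
    rw [List.all_eq_true] at hall
    obtain ⟨l, hl, hls⟩ := hψ C hC
    have hv := hn C hC l hl
    have hcode := hall l hl
    simp only [Bool.or_eq_true, decide_eq_true_eq] at hcode
    have : ∃ i < 3, σ (claimVar n H 0 i l.code) = true := by
      rcases hcode with (hcode | hcode) | hcode <;> rw [hcode]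
      exacts [⟨0, by omega, ha'⟩, ⟨1, by omega, hb'⟩, ⟨2, by omega, hc'⟩]
    obtain ⟨i, hi, hcl⟩ := this
    have htop := h.1 i hi l.var (by omega)
    rw [hs _ hv.le] at htop
    rw [Literal.Holds] at hls
    rw [Literal.code] at hcl
    cases hpos : l.positive
    · have := htop.2 (by simpa [hpos] using hcl)
      rw [hls, hpos] at this
      exact absurd this (by simp)
    · have := htop.1 (by simpa [hpos] using hcl)
      rw [hls, hpos] at this
      exact absurd this (by simp)
  · obtain ⟨a, ha, ha'⟩ := exists_testBit (2 ^ (H - (d + 1))) fun t => σ (bitVar n H (d + 1) 0 t)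
    obtain ⟨b, hb, hb'⟩ := exists_testBit (2 ^ (H - (d + 1))) fun t => σ (bitVar n H (d + 1) 1 t)
    have hclaim := h.2 a ha b hb ((hσ (d + 1) (by omega) 0 (by omega) a ha).2 ha')
      ((hσ (d + 1) (by omega) 1 (by omega) b hb).2 hb')
    have hm := (hσ d (by omega) i hi _ (claim_lt_tower hd ha hb)).1 hclaim t ht
    rw [Matches.testBit_pair hd ha ha' hb' ht] at hm
    exact h.1 hm.symm
  · have h0 := hσ H (by omega) i hi 0 (by simp [tower])
    have h1 := hσ H (by omega) i hi 1 (by simp [tower])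
    have hm : ∀ c, Matches n H σ H i c ↔ c.testBit 0 = σ (bitVar n H H i 0) := by
      intro c; simp [Matches]
    rw [hm] at h0 h1
    rcases hv : σ (bitVar n H H i 0) with _ | _
    · rw [hv, h.1 hv] at h1; simp at h1
    · rw [hv, h.2 hv] at h0; simp at h0

/-- Strategy of the universal player: claim exactly what is true of the strings just written. -/
theorem not_quantifiedTrue_of_honest {s : ℕ → Bool} (hψ : ψ.Holds s) (hn : ψ.VarsLT n)
    (hH : 2 * n + 2 ≤ tower H) (k d : ℕ) (hk : d + k = H + 1) (hs : ∀ v ≤ n, σ v = s v)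
    (hσ : Honest n H d σ) :
    ¬ QuantifiedTrue (matrix n H ψ) ((List.range' d k).flatMap (blockQuants H) ++
      List.replicate (2 * numGates H + 1) Quantifier.ex) (blockStart n H d) σ := by
  induction k generalizing d σ with
  | zero =>
    obtain rfl : d = H + 1 := by omega
    simp only [List.range'_zero, List.flatMap_nil, List.nil_append]
    rw [quantifiedTrue_gates hH]
    exact not_someSound_of_honest hψ hn hs hσ
  | succ k ih =>
    rw [quantifiedTrue_block]
    rintro ⟨b, hb⟩
    -- Position `j` of the reply belongs to string `j / tower (H - d)` and value `j % tower (H -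
    -- d)`.
    refine ih (d + 1) (by omega) ?_ ?_ (hb fun j => decide (∀ t < 2 ^ (H - d),
      (j % tower (H - d)).testBit t = b (j / tower (H - d) * 2 ^ (H - d) + t)))
    · intro v hv
      rw [move_of_lt (lt_blockStart _ hv), hs v hv]
    · intro d' hd' i hi c hc
      rcases Nat.lt_succ_iff_lt_or_eq.1 hd' with hd' | rfl
      · rw [move_of_lt (claimVar_lt hd' hi hc), hσ d' hd' i hi c hc]
        exact (Matches.congr hi fun v hv => move_of_lt (hv.trans_le (blockStart_mono hd'))).symm
      · have hT : 0 < tower (H - d') := by rw [tower]; positivity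
        rw [move_claimVar hi hc, decide_eq_true_eq, mul_comm i, Nat.mul_add_div hT,
          Nat.div_eq_of_lt hc, Nat.mul_add_mod, Nat.mod_eq_of_lt hc, add_zero, Matches]
        refine forall₂_congr fun t ht => ?_
        rw [bitVar, move_add (mul_add_lt hi ht)]

variable (n H σ) in
/-- Some claim in the block of depth `d` is false. -/
def Lie (d : ℕ) : Prop :=
  ∃ i < 3, ∃ c < tower (H - d), σ (claimVar n H d i c) = true ∧ ¬ Matches n H σ d i c

/-- Strategy of the existential player, with the hypothesis `h` as invariant: against a lie with
value `c`, write `c` in the next block. If the reply contains no lie, the only values it can claim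
for the halves compose to `c`, and the gate of a bit where `c` and the string differ is sound.
Otherwise the lie has moved one block on, down to single bits. -/
theorem quantifiedTrue_of_lie (hH : 2 * n + 2 ≤ tower H) (k d : ℕ) (hk : d + k = H)
    (h : SomeSound n H ψ (d + 1) σ ∨ Lie n H σ d) :
    QuantifiedTrue (matrix n H ψ) ((List.range' (d + 1) k).flatMap (blockQuants H) ++
      List.replicate (2 * numGates H + 1) Quantifier.ex) (blockStart n H (d + 1)) σ := by
  induction k generalizing d σ with
  | zero =>
    obtain rfl : d = H := by omega
    simp only [List.range'_zero, List.flatMap_nil, List.nil_append]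
    rw [quantifiedTrue_gates hH]
    rcases h with h | ⟨i, hi, c, hc, hcl, hm⟩
    · exact h
    · refine .inr (.inr ⟨by omega, i, hi, ?_⟩)
      have hc : c < 2 := by simpa [tower] using hc
      have hm : ¬ c.testBit 0 = σ (bitVar n d d i 0) := by simpa [Matches] using hm
      interval_cases c
      · rw [Nat.zero_testBit] at hm
        exact ⟨fun h => absurd h.symm hm, fun _ => hcl⟩
      · rw [Nat.testBit_one_zero] at hm
        exact ⟨fun _ => hcl, fun h => absurd h.symm hm⟩
  | succ k ih =>
    rw [quantifiedTrue_block]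
    rcases h with h | ⟨i, hi, c, hc, hcl, hm⟩
    · exact ⟨fun _ => false, fun b' => ih (d + 1) (by omega)
        (.inl ((h.congr hH fun v hv => move_of_lt hv).mono (by omega)))⟩
    -- The bits of `c` fill strings `0` and `1`; the third string is not needed in this attack.
    · refine ⟨fun j => c.testBit j, fun b' => ih (d + 1) (by omega) ?_⟩
      by_cases hlie : Lie n H (move n H σ (d + 1) (fun j => c.testBit j) b') (d + 1)
      · exact .inr hlie
      have hd : d < H := by omega
      have hbit : ∀ t < 2 ^ (H - d), move n H σ (d + 1) (fun j => c.testBit j) b'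
          (bitVar n H (d + 1) 0 t) = c.testBit t := by
        intro t ht
        rw [two_pow_sub hd] at ht
        rw [bitVar, move_add (by omega), zero_mul, zero_add]
      have hmove : ∀ v < blockStart n H (d + 1),
          move n H σ (d + 1) (fun j => c.testBit j) b' v = σ v := fun v hv => move_of_lt hv
      generalize move n H σ (d + 1) (fun j => c.testBit j) b' = τ at hlie hbit hmove
      have hhonest : ∀ i < 3, ∀ a < tower (H - (d + 1)), τ (claimVar n H (d + 1) i a) = true →
          Matches n H τ (d + 1) i a := by
        intro i hi a ha h
        by_contra hne
        exact hlie ⟨i, hi, a, ha, h, hne⟩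
      have hm' : ∃ t < 2 ^ (H - d), c.testBit t ≠ σ (bitVar n H d i t) := by
        simpa [Matches] using hm
      obtain ⟨t, ht, hne⟩ := hm'
      refine .inl (.inr (.inl ⟨d, by omega, hd, i, hi, t, ht, ?_, ?_⟩))
      · rw [hbit t ht, hmove _ (bitVar_lt' (by omega) hi ht)]
        exact hne.symm
      · intro a ha b hb hca hcb
        have : tower (H - (d + 1)) * b + a = c := by
          refine eq_of_testBit (claim_lt_tower hd ha hb) hc fun t ht => ?_
          rw [Matches.testBit_pair hd ha (hhonest 0 (by omega) a ha hca)
            (hhonest 1 (by omega) b hb hcb) ht, hbit t ht]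
        rw [this, hmove _ (claimVar_lt (by omega) hi hc)]
        exact hcl

/-- The literal with the given code is false. -/
def FalseCode (n : ℕ) (σ : ℕ → Bool) (c : ℕ) : Prop :=
  c < 2 * n + 2 ∧ ∀ v, (2 * v = c → σ v = false) ∧ (2 * v + 1 = c → σ v = true)

/-- One of the two literals of the spare variable `n` is false. -/
theorem exists_falseCode (n : ℕ) (σ : ℕ → Bool) : ∃ c, FalseCode n σ c := by
  cases h : σ n
  · refine ⟨2 * n, by omega, fun v => ⟨fun hv => ?_, by omega⟩⟩
    rwa [show v = n by omega]
  · refine ⟨2 * n + 1, by omega, fun v => ⟨by omega, fun hv => ?_⟩⟩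
    rwa [show v = n by omega]

theorem falseCode_code {l : Literal} (hl : l.var < n) (h : ¬ l.Holds σ) :
    FalseCode n σ l.code := by
  rw [Literal.Holds] at h
  cases hp : l.positive
  · rw [hp, Bool.not_eq_false] at h
    simp only [Literal.code, hp, Bool.false_eq_true, if_false]
    refine ⟨by omega, fun v => ⟨by omega, fun hv => ?_⟩⟩
    rwa [show v = l.var by omega]
  · rw [hp, Bool.not_eq_true] at h
    simp only [Literal.code, hp, if_true]
    refine ⟨by omega, fun v => ⟨fun hv => ?_, by omega⟩⟩
    rwa [show v = l.var by omega]

/-- The codes are those of a falsified clause, padded by a false literal of the spare variable; this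
covers even the empty clause. -/
theorem exists_covers (hn : ψ.VarsLT n) (h3 : ψ.ArityLE 3) (h : ¬ ψ.Holds σ) :
    ∃ c : ℕ → ℕ, (∀ i, FalseCode n σ (c i)) ∧ ψ.covers (c 0) (c 1) (c 2) = true := by
  obtain ⟨c₀, hc₀⟩ := exists_falseCode n σ
  simp only [CNF.Holds, not_forall, not_exists, not_and] at h
  obtain ⟨C, hC, hl⟩ := h
  refine ⟨fun i => (C[i]?).elim c₀ Literal.code, fun i => ?_, ?_⟩
  · rcases hi : C[i]? with _ | l
    · simpa only [hi, Option.elim] using hc₀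
    · have hl' := List.mem_of_getElem? hi
      simpa only [hi, Option.elim] using falseCode_code (hn C hC l hl') (hl l hl')
  · rw [CNF.covers, List.any_eq_true]
    refine ⟨C, hC, ?_⟩
    rw [List.all_eq_true]
    intro l hl'
    obtain ⟨i, hi, rfl⟩ := List.mem_iff_getElem.1 hl'
    have := h3 C hC
    have hi3 : i < 3 := by omega
    simp only [Bool.or_eq_true, decide_eq_true_eq]
    interval_cases i <;> simp [hi]

/-- The opening move writes the codes of a falsified clause. If the reply contains no lie, no other
values are claimed and the first gate is sound; otherwise `quantifiedTrue_of_lie` takes over. -/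
theorem quantifiedTrue_of_not_holds (hn : ψ.VarsLT n) (h3 : ψ.ArityLE 3)
    (hH : 2 * n + 2 ≤ tower H) (h : ¬ ψ.Holds σ) :
    QuantifiedTrue (matrix n H ψ) ((List.range' 0 (H + 1)).flatMap (blockQuants H) ++
      List.replicate (2 * numGates H + 1) Quantifier.ex) (blockStart n H 0) σ := by
  obtain ⟨c, hc, hcov⟩ := exists_covers hn h3 h
  rw [quantifiedTrue_block]
  refine ⟨fun j => (c (j / 2 ^ (H - 0))).testBit (j % 2 ^ (H - 0)), fun b' =>
    quantifiedTrue_of_lie hH H 0 (by omega) ?_⟩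
  have hmove : ∀ v ≤ n, move n H σ 0 (fun j => (c (j / 2 ^ (H - 0))).testBit (j % 2 ^ (H - 0)))
      b' v = σ v := fun v hv => move_of_lt (lt_blockStart _ hv)
  have hbit : ∀ i < 3, Matches n H (move n H σ 0
      (fun j => (c (j / 2 ^ (H - 0))).testBit (j % 2 ^ (H - 0))) b') 0 i (c i) := by
    intro i hi t ht
    have hpos : 0 < 2 ^ (H - 0) := by positivity
    rw [bitVar, move_add (mul_add_lt hi ht), mul_comm i, Nat.mul_add_div hpos,
      Nat.div_eq_of_lt ht, Nat.mul_add_mod, Nat.mod_eq_of_lt ht, add_zero]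
  generalize move n H σ 0 (fun j => (c (j / 2 ^ (H - 0))).testBit (j % 2 ^ (H - 0))) b' = τ
    at hbit hmove
  by_cases hlie : Lie n H τ 0
  · exact .inr hlie
  have hhonest : ∀ i < 3, ∀ a < tower H, τ (claimVar n H 0 i a) = true → a = c i := by
    intro i hi a ha h
    by_contra hne
    refine hlie ⟨i, hi, a, ha, h, fun hm => hne ?_⟩
    refine eq_of_testBit ha ((hc i).1.trans_le hH) fun t ht => ?_
    rw [hm t ht, hbit i hi t ht]
  refine .inl (.inl ⟨by omega, fun i hi v hv => ⟨fun h => ?_, fun h => ?_⟩, ?_⟩)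
  · rw [hmove v (by omega)]
    exact ((hc i).2 v).1 (hhonest i hi _ (by omega) h)
  · rw [hmove v (by omega)]
    exact ((hc i).2 v).2 (hhonest i hi _ (by omega) h)
  · intro x hx y hy z hz h₀ h₁ h₂
    rw [hhonest 0 (by omega) x hx h₀, hhonest 1 (by omega) y hy h₁, hhonest 2 (by omega) z hz h₂]
    exact hcov

theorem quantifiedTrue_iff (hn : ψ.VarsLT n) (h3 : ψ.ArityLE 3) (hH : 2 * n + 2 ≤ tower H) :
    QuantifiedTrue (matrix n H ψ) (quants n H) 0 σ ↔ ¬ ∃ s, ψ.Holds s := by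
  have h0 : 0 + (n + 1) = blockStart n H 0 := by simp [blockStart]
  rw [quants, quantifiedTrue_all_block, h0, List.range_eq_range']
  constructor
  · rintro h ⟨s, hs⟩
    refine not_quantifiedTrue_of_honest hs hn hH (H + 1) 0 (by omega) (fun v hv => ?_) ?_ (h s)
    · rw [overwrite, if_pos (by omega), Nat.sub_zero]
    · exact fun d' hd' => absurd hd' (by omega)
  · exact fun h b => quantifiedTrue_of_not_holds hn h3 hH fun hs => h ⟨_, hs⟩

/-- The depth of the construction for `n` variables. -/
def depth (n : ℕ) : ℕ := Nat.log 2 (Nat.log 2 (2 * n + 2)) + 1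

theorem two_pow_depth_le (n : ℕ) : 2 ^ depth n ≤ 2 * Nat.log 2 (2 * n + 2) := by
  have : Nat.log 2 (2 * n + 2) ≠ 0 := (Nat.log_pos (by norm_num) (by omega)).ne'
  rw [depth, pow_succ']
  exact Nat.mul_le_mul_left _ (Nat.pow_log_le_self 2 this)

theorem le_tower_depth (n : ℕ) : 2 * n + 2 ≤ tower (depth n) := by
  have h₁ : Nat.log 2 (2 * n + 2) < 2 ^ depth n := Nat.lt_pow_succ_log_self (by norm_num) _
  have h₂ : 2 * n + 2 < 2 ^ (Nat.log 2 (2 * n + 2) + 1) := Nat.lt_pow_succ_log_self (by norm_num) _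
  exact h₂.le.trans (Nat.pow_le_pow_right (by norm_num) h₁)

/-- Rounding up the double logarithm at most doubles the exponent, hence at most squares the number
of values. This keeps the matrix polynomial. -/
theorem tower_depth_le (n : ℕ) : tower (depth n) ≤ (2 * n + 2) * (2 * n + 2) := by
  have h := Nat.pow_log_le_self 2 (show 2 * n + 2 ≠ 0 by omega)
  refine (Nat.pow_le_pow_right (by norm_num) (two_pow_depth_le n)).trans ?_
  rw [two_mul, pow_add]
  exact Nat.mul_le_mul h h

end Refutation

open Refutation in
/-- The quantified formula that is true when the given 3-CNF is not satisfiable. -/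
def SATInstance.refutation (φ : SATInstance 3) : QBF 4 where
  quants := quants φ.numVars (depth φ.numVars)
  formula := matrix φ.numVars (depth φ.numVars) φ.formula
  arity := (bounded_matrix φ.formula (le_tower_depth _)).1
  vars := (bounded_matrix φ.formula (le_tower_depth _)).2

theorem SATInstance.refutation_isTrue (φ : SATInstance 3) :
    φ.refutation.IsTrue ↔ ¬ φ.Satisfiable :=
  Refutation.quantifiedTrue_iff φ.vars φ.arity (Refutation.le_tower_depth _)

theorem SATInstance.numExistential_refutation (φ : SATInstance 3) :
    φ.refutation.numExistential = 3 * Refutation.numGates (Refutation.depth φ.numVars) :=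
  Refutation.count_quants

open StringRep ListRep Emitter

/-! ### Computing the reduction -/

namespace Computes

open Refutation

variable {α : Type} [StringRep α]

attribute [fun_prop] replicate

@[fun_prop]
theorem depth {n : α → ℕ} (hn : Computes n) : Computes fun a => depth (n a) := by
  have h : Computes fun n : ℕ => Nat.log 2 (Nat.log 2 (2 * n + 2)) + 1 :=
    (log.comp (log.comp (by fun_prop))).add (const 1)
  exact h.comp hn

@[fun_prop]
theorem two_pow_depth_sub {n d : α → ℕ} (hn : Computes n) (hd : Computes d) :
    Computes fun a => 2 ^ (Refutation.depth (n a) - d a) := by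
  refine two_pow (g := fun a => 2 * (2 * n a + 2)) (by fun_prop) (by fun_prop) fun a => ?_
  refine (Nat.pow_le_pow_right (by norm_num) (Nat.sub_le _ _)).trans
    ((two_pow_depth_le _).trans ?_)
  exact Nat.mul_le_mul_left _ (Nat.log_le_self _ _)

-- The quadratic bound on the number of values makes this double exponential accessible to the
-- search in `two_pow`.
@[fun_prop]
theorem tower_depth_sub {n d : α → ℕ} (hn : Computes n) (hd : Computes d) :
    Computes fun a => tower (Refutation.depth (n a) - d a) := by
  refine two_pow (g := fun a => (2 * n a + 2) * (2 * n a + 2)) (by fun_prop) (by fun_prop)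
    fun a => ?_
  exact (Nat.pow_le_pow_right (by norm_num) (Nat.pow_le_pow_right (by norm_num)
    (Nat.sub_le _ _))).trans (tower_depth_le _)

@[fun_prop]
theorem tower_depth {n : α → ℕ} (hn : Computes n) :
    Computes fun a => tower (Refutation.depth (n a)) :=
  tower_depth_sub hn (const 0)

@[fun_prop]
theorem blockStart {n d : α → ℕ} (hn : Computes n) (hd : Computes d) :
    Computes fun a => blockStart (n a) (Refutation.depth (n a)) (d a) := by
  unfold Refutation.blockStart
  fun_prop

@[fun_prop]
theorem gate {n d i t : α → ℕ} (hn : Computes n) (hd : Computes d) (hi : Computes i)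
    (ht : Computes t) : Computes fun a => gate (Refutation.depth (n a)) (d a) (i a) (t a) := by
  unfold Refutation.gate gateStart
  fun_prop

@[fun_prop]
theorem numGates {n : α → ℕ} (hn : Computes n) :
    Computes fun a => numGates (Refutation.depth (n a)) := by
  unfold Refutation.numGates gateStart
  fun_prop

@[fun_prop]
theorem bitVar {n d i t : α → ℕ} (hn : Computes n) (hd : Computes d) (hi : Computes i)
    (ht : Computes t) :
    Computes fun a => bitVar (n a) (Refutation.depth (n a)) (d a) (i a) (t a) := by
  unfold Refutation.bitVar
  fun_prop

@[fun_prop]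
theorem claimVar {n d i c : α → ℕ} (hn : Computes n) (hd : Computes d) (hi : Computes i)
    (hc : Computes c) :
    Computes fun a => claimVar (n a) (Refutation.depth (n a)) (d a) (i a) (c a) := by
  unfold Refutation.claimVar
  fun_prop

@[fun_prop]
theorem gateVar {n c : α → ℕ} (hn : Computes n) (hc : Computes c) :
    Computes fun a => gateVar (n a) (Refutation.depth (n a)) (c a) := by
  unfold Refutation.gateVar
  fun_prop

@[fun_prop]
theorem chainVar {n c : α → ℕ} (hn : Computes n) (hc : Computes c) :
    Computes fun a => chainVar (n a) (Refutation.depth (n a)) (c a) := by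
  unfold Refutation.chainVar
  fun_prop

theorem quants {n : α → ℕ} (hn : Computes n) :
    Computes fun a => quants (n a) (Refutation.depth (n a)) := by
  unfold Refutation.quants blockQuants
  fun_prop

theorem clause_one {x : α → ℕ} (b : Bool) (hx : Computes x) :
    Computes fun a => ([[⟨x a, b⟩]] : CNF) :=
  clause (literal b hx)

theorem clause_three {x y z : α → ℕ} (b b' b'' : Bool) (hx : Computes x) (hy : Computes y)
    (hz : Computes z) : Computes fun a => ([[⟨x a, b⟩, ⟨y a, b'⟩, ⟨z a, b''⟩]] : CNF) :=
  clause ((literal b hx).append ((literal b' hy).append (literal b'' hz)))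

theorem clause_four {x y z w : α → ℕ} (b b' b'' b₃ : Bool) (hx : Computes x) (hy : Computes y)
    (hz : Computes z) (hw : Computes w) :
    Computes fun a => ([[⟨x a, b⟩, ⟨y a, b'⟩, ⟨z a, b''⟩, ⟨w a, b₃⟩]] : CNF) :=
  clause ((literal b hx).append ((literal b' hy).append ((literal b'' hz).append (literal b₃ hw))))

theorem chainClauses {n : α → ℕ} (hn : Computes n) :
    Computes fun a => chainClauses (n a) (Refutation.depth (n a)) := by
  refine (clause_one _ ?_).append ((flatMap_range (clause_three _ _ _ ?_ ?_ ?_) ?_).append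
    (clause_one _ ?_)) <;> fun_prop

attribute [fun_prop] numVars

theorem topClauses {φ : α → SATInstance 3} (hφ : Computes φ) :
    Computes fun a => topClauses (φ a).numVars (Refutation.depth (φ a).numVars)
      (φ a).formula := by
  refine (flatMap_range (flatMap_range ((clause_three _ _ _ ?_ ?_ ?_).append
    (clause_three _ _ _ ?_ ?_ ?_)) ?_) ?_).append (flatMap_range (flatMap_range (flatMap_range
    (cond (covers ?_ ?_ ?_ ?_) (const []) (clause_four _ _ _ _ ?_ ?_ ?_ ?_)) ?_) ?_) ?_) <;>
    fun_prop

theorem stepClauses {n d : α → ℕ} (hn : Computes n) (hd : Computes d) :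
    Computes fun a => stepClauses (n a) (Refutation.depth (n a)) (d a) := by
  refine flatMap_range (flatMap_range ((clause_three _ _ _ ?_ ?_ ?_).append
    ((clause_three _ _ _ ?_ ?_ ?_).append (flatMap_range (flatMap_range
    (clause_four _ _ _ _ ?_ ?_ ?_ ?_) ?_) ?_))) ?_) ?_ <;>
    fun_prop

theorem baseClauses {n : α → ℕ} (hn : Computes n) :
    Computes fun a => baseClauses (n a) (Refutation.depth (n a)) := by
  refine flatMap_range ((clause_three _ _ _ ?_ ?_ ?_).append
    (clause_three _ _ _ ?_ ?_ ?_)) ?_ <;> fun_prop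

theorem refutation : Computes fun φ : SATInstance 3 => φ.refutation.encode := by
  have hq : Computes fun φ : SATInstance 3 => (φ.refutation.quants.map Quantifier.encode) :=
    quants (by fun_prop : Computes fun φ : SATInstance 3 => φ.numVars)
  have hm : Computes fun φ : SATInstance 3 => φ.refutation.formula :=
    (chainClauses numVars).append ((topClauses id).append
      ((flatMap_range (stepClauses (by fun_prop) (by fun_prop)) (by fun_prop)).append
        (baseClauses numVars)))
  have hm' : Computes fun φ : SATInstance 3 => φ.refutation.formula.encode := hm
  exact hq.append hm'

end Computes

open Filter StackProgram

instance : Inhabited InputSymbol := ⟨InputSymbol.tick⟩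

/-! ### Growth of the number of existential variables -/

namespace Refutation

/-- Geometric series: 3(2^H + … + 1) = 6 · 2^H − 3, and one more for the first gate. -/
theorem numGates_eq (H : ℕ) : numGates H + 2 = 6 * 2 ^ H := by
  have : ∀ d ≤ H, gateStart H d + 6 * 2 ^ (H - d) = 1 + 6 * 2 ^ H := by
    intro d hd
    induction d with
    | zero => simp [gateStart]
    | succ d ih =>
      have := ih (by omega)
      rw [two_pow_sub (by omega)] at this
      rw [gateStart_succ, two_pow_sub (by omega)]
      omega
  have := this H le_rfl
  rw [numGates, gateStart_succ]
  rw [Nat.sub_self] at this ⊢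
  omega

/-- The number of existential variables for `n` variables. -/
def existentials (n : ℕ) : ℕ := 3 * numGates (depth n)

theorem existentials_le (n : ℕ) : existentials n ≤ 36 * Nat.log 2 (2 * n + 2) := by
  have := numGates_eq (depth n)
  have := two_pow_depth_le n
  rw [existentials]
  omega

/-- The hypothesis f(k) = o(k) concerns large k only, so k has to grow with n. -/
theorem tendsto_existentials : Tendsto existentials atTop atTop := by
  have hlog : Tendsto (fun n => Nat.log 2 n) atTop atTop :=
    tendsto_atTop.2 fun m => (eventually_ge_atTop (2 ^ m)).mono fun n hn =>
      (Nat.le_log_iff_pow_le (by norm_num) (by have := Nat.one_le_two_pow (n := m); omega)).2 hn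
  have h : Tendsto (fun n : ℕ => 2 * n + 2) atTop atTop :=
    tendsto_atTop_mono (fun n => by simp only [id]; omega) tendsto_id
  refine tendsto_atTop_mono (fun n => ?_) (hlog.comp (hlog.comp h))
  have := numGates_eq (depth n)
  have := (Nat.lt_two_pow_self (n := depth n))
  have : Nat.log 2 (Nat.log 2 (2 * n + 2)) + 1 = depth n := rfl
  simp only [Function.comp, existentials]
  omega

/-- The exponent `2 ^ o(k)` is sublinear in the number of variables. -/
theorem isLittleO_two_rpow {f : ℕ → ℝ} (hf : f =o[atTop] fun k : ℕ => (k : ℝ)) :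
    (fun n => (2 : ℝ) ^ f (existentials n)) =o[atTop] fun n : ℕ => (n : ℝ) := by
  have h₁ : (fun n : ℕ => √((2 * n + 2 : ℕ) : ℝ)) =o[atTop] fun n : ℕ => (n : ℝ) := by
    refine Asymptotics.isLittleO_iff.2 fun c hc => ?_
    filter_upwards [eventually_ge_atTop 1,
      tendsto_natCast_atTop_atTop.eventually (eventually_ge_atTop (4 / c ^ 2))] with n hn hn'
    rw [Real.norm_of_nonneg (by positivity), Real.norm_of_nonneg (by positivity)]
    refine Real.sqrt_le_iff.2 ⟨by positivity, ?_⟩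
    have hn₁ : (1 : ℝ) ≤ n := by exact_mod_cast hn
    rw [div_le_iff₀ (by positivity)] at hn'
    push_cast
    calc (2 : ℝ) * n + 2 ≤ 4 * n := by linarith
      _ ≤ n * c ^ 2 * n := mul_le_mul_of_nonneg_right hn' (by positivity)
      _ = (c * n) ^ 2 := by ring
  refine Asymptotics.IsBigO.trans_isLittleO (Asymptotics.IsBigO.of_bound 1 ?_) h₁
  -- With at most 36 log(2n+2) existential variables, the constant 1/72 gives f ≤ log(2n+2)/2, and
  -- so 2^f ≤ √(2n+2).
  have hev := tendsto_existentials.eventually (hf.bound (show (0 : ℝ) < 1 / 72 by norm_num))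
  refine hev.mono fun n hn => ?_
  rw [one_mul, Real.norm_of_nonneg (by positivity), Real.norm_of_nonneg (by positivity)]
  have hle : f (existentials n) ≤ (Nat.log 2 (2 * n + 2) : ℝ) * (1 / 2) := by
    have h := (Real.norm_eq_abs _ ▸ le_abs_self (f (existentials n))).trans hn
    have h' : (existentials n : ℝ) ≤ 36 * (Nat.log 2 (2 * n + 2) : ℝ) := by
      exact_mod_cast existentials_le n
    rw [Real.norm_of_nonneg (by positivity)] at h
    linarith
  refine (Real.rpow_le_rpow_of_exponent_le (by norm_num) hle).trans ?_
  rw [Real.rpow_mul (by norm_num), Real.rpow_natCast, ← Real.sqrt_eq_rpow]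
  refine Real.sqrt_le_sqrt ?_
  exact_mod_cast Nat.pow_log_le_self 2 (by omega)

end Refutation

/-! ### The reduction as a program, and the contradiction with ETH -/

theorem SATInstance.exists_program_refutation : ∃ (c : StackProgram InputSymbol)
    (q : Polynomial ℕ), ∀ φ : SATInstance 3, φ.refutation.encode.length ≤ q.eval φ.encode.length ∧
      ∃ t ≤ q.eval φ.encode.length, Runs c (Function.update (fun _ => []) 4 φ.encode)
        (Function.update (fun _ => []) 1 φ.refutation.encode.reverse) t := by
  obtain ⟨e, he⟩ := Computes.refutation 0
  obtain ⟨c, q, h⟩ := Emitter.exists_program (A := InputSymbol) e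
  refine ⟨c, q, fun φ => ?_⟩
  have he' : Emitter.eval (n := 1) e (fun _ => φ.encode) = φ.refutation.encode := he φ
  rw [← he']
  exact h φ.encode

theorem theorem1 (hETH : ETH) :
    ¬ ∃ (f : ℕ → ℝ) (p : Polynomial ℕ), f =o[Filter.atTop] (fun k : ℕ => (k : ℝ)) ∧
      DecidableInTime (QBF.encode (d := 4)) QBF.IsTrue
        (fun φ => (2 : ℝ) ^ ((2 : ℝ) ^ f φ.numExistential) * (p.eval φ.encode.length : ℕ)) := by
  rintro ⟨f, p, hf, hM⟩
  obtain ⟨c, q, hc⟩ := SATInstance.exists_program_refutation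
  have hdec := DecidableInTime.of_program (P := SATInstance.Satisfiable)
    (fun φ : SATInstance 3 => by rw [SATInstance.refutation_isTrue, not_not])
    c 4 1 (fun φ : SATInstance 3 => q.eval φ.encode.length) (fun φ => (hc φ).2) hM
  -- The part `2 * q + 1` pays for computing and transferring the formula, `p.comp q` for deciding a
  -- formula of length at most `q`.
  refine hETH ⟨_, 2 * q + 1 + p.comp q, Refutation.isLittleO_two_rpow hf, ?_⟩
  obtain ⟨M, hM⟩ := hdec
  refine ⟨M, fun φ => ?_⟩
  obtain ⟨answer, ha, t, ht, h⟩ := hM φ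
  refine ⟨answer, ha, t, ht.trans ?_, h⟩
  have hlen := (hc φ).1
  have hp := p.eval_mono_nat hlen
  beta_reduce
  rw [show φ.refutation.numExistential = Refutation.existentials φ.numVars from
    φ.numExistential_refutation]
  set E := (2 : ℝ) ^ (2 : ℝ) ^ f (Refutation.existentials φ.numVars) with hE
  -- Since the exponential factor is at least 1, it absorbs the additive cost of the reduction.
  have hE1 : 1 ≤ E := Real.one_le_rpow (by norm_num) (by positivity)
  have h₁ : ((q.eval φ.encode.length + (φ.refutation.encode.length + 1) : ℕ) : ℝ) ≤
      E * (2 * q.eval φ.encode.length + 1 : ℕ) := by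
    refine le_trans ?_ (le_mul_of_one_le_left (by positivity) hE1)
    exact_mod_cast by omega
  have h₂ : E * (p.eval φ.refutation.encode.length : ℕ) ≤
      E * (p.eval (q.eval φ.encode.length) : ℕ) :=
    mul_le_mul_of_nonneg_left (by exact_mod_cast hp) (by positivity)
  refine (add_le_add h₁ h₂).trans (le_of_eq ?_)
  rw [← mul_add]
  simp [Polynomial.eval_comp]
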